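/- Let $K$ be $\mathbb C(t)$ or an extension field of it, let $M_1,M_2,N\ge 0$ be integers and $u_1,\dots,u_N\in K\setminus\{0\}$. **Two-site $q$-boson model ($q=t$).** On the Fock space with basis $|n\rangle$, $n\ge0$, let $B^\dagger|n\rangle=|n+1\rangle$ and $B|n\rangle=\frac{1-t^n}{1-t}|n-1\rangle$ (so $B|0\rangle=0$). Let $\mathcal F=\mathcal F^{(1)}\otimes\mathcal F^{(2)}$, where $\mathcal F^{(k)}=\bigotimes_{i=0}^{M_k}\mathcal F^{(k)}_i$ is a tensor product of $M_k+1$ copies of the Fock space, let $B_i^{(k)\dagger},B_i^{(k)}$ act as $B^\dagger,B$ in the factor $\mathcal F_i^{(k)}$ and identically in all other factors, and let $$L^{(k)}_i(u)=\begin{pmatrix}u^{-1}&B_i^{(k)\dagger}\\(1-t)B_i^{(k)}&u\end{pmatrix},\qquad L^{(k)}_{M_k}(u)\cdots L^{(k)}_0(u)=\begin{pmatrix}A_k(u)&B_k(u)\\C_k(u)&D_k(u)\end{pmatrix}\quad(k=1,2).$$ Let $|0\rangle\in\mathcal F$ be the tensor product of all vacuum vectors and $|\tilde\Psi_N\rangle=\prod_{j=1}^N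 B_2(u_j)B_1(u_j)\,|0\rangle$ (factors ordered by $j$ from left to right). **Hall-Littlewood polynomials.** For a Young diagram $\lambda$ with at most $N$ rows, let $m_i(\lambda)$ be the number of $j\in\{1,\dots,N\}$ with $\lambda_j=i$ (so $m_0(\lambda)=N-\ell(\lambda)$), and let $$P_\lambda(x_1,\dots,x_N)=\Big(\prod_{i\ge0}\prod_{k=1}^{m_i(\lambda)}\tfrac{1-t^k}{1-t}\Big)^{-1}\sum_{w\in S_N}w\Big(x_1^{\lambda_1}\cdots x_N^{\lambda_N}\prod_{i<j}\frac{x_i-tx_j}{x_i-x_j}\Big),$$ which is a polynomial. **Coupled Hall-Littlewood functions.** For variables $\mathbf x=(x_1,x_2,\dots)$, $\mathbf y=(y_1,y_2,\dots)$ let $\sum_{n\ge0}q_n(\mathbf x)z^n=\exp\big(\sum_{n\ge1}(1-t^n)x_nz^n\big)$ and $q_n=0$ for $n<0$. For integer sequences $\alpha,\beta$ put $q_{[\alpha,\beta]}=\prod_iq_{\alpha_i}(\mathbf x)\prod_aq_{\beta_a}(\mathbf y)$. For Young diagrams $\lambda,\mu$ (as the sequences of their nonzero parts), $$Q_{[\lambda,\mu]}(\mathbf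 x,\mathbf y)=\prod_{i<j}\frac{1-R_{\lambda_i\lambda_j}}{1-tR_{\lambda_i\lambda_j}}\prod_{a<b}\frac{1-R_{\mu_a\mu_b}}{1-tR_{\mu_a\mu_b}}\prod_{i,a}\frac{(1-D_{\lambda_i\mu_a})(1-t^2D_{\lambda_i\mu_a})}{(1-tD_{\lambda_i\mu_a})^2}\;q_{[\lambda,\mu]}\in K[\mathbf x,\mathbf y],$$ where the operators act on the index of $q_{[\cdot,\cdot]}$: $R_{\lambda_i\lambda_j}$ (resp. $R_{\mu_a\mu_b}$) raises the $i$th ($a$th) entry and lowers the $j$th ($b$th) entry of the first (second) sequence by $1$, $D_{\lambda_i\mu_a}$ lowers the $i$th entry of the first and the $a$th entry of the second sequence by $1$, and the fractions are expanded as power series in these operators (only finitely many terms are nonzero). Let $\jmath:\mathcal F\to K[\mathbf x,\mathbf y]$ be the linear map that sends $\bigotimes_{i=0}^{M_1}|n_i\rangle^{(1)}_i\otimes\bigotimes_{i=0}^{M_2}|m_i\rangle^{(2)}_i$ to $Q_{[\lambda,\mu]}$ with $\lambda=1^{n_1}2^{n_2}\cdots M_1^{n_{M_1}}$ and $\mu=1^{m_1}2^{m_2}\cdots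 M_2^{m_{M_2}}$. **Proposition.** With sums over the Young diagrams $\lambda$ with at most $N$ rows and at most $M_1$ columns and $\mu$ with at most $N$ rows and at most $M_2$ columns, $$|\tilde\Psi_N\rangle=(u_1\cdots u_N)^{-M_1-M_2}\sum_{\lambda,\mu}P_\lambda(u_1^2,\dots,u_N^2)P_\mu(u_1^2,\dots,u_N^2)\bigotimes_{i=0}^{M_1}|m_i(\lambda)\rangle^{(1)}_i\otimes\bigotimes_{i=0}^{M_2}|m_i(\mu)\rangle^{(2)}_i$$ in $\mathcal F$, and $$\jmath\big(|\tilde\Psi_N\rangle\big)=(u_1\cdots u_N)^{-M_1-M_2}\sum_{\lambda,\mu}P_\lambda(u_1^2,\dots,u_N^2)P_\mu(u_1^2,\dots,u_N^2)\,Q_{[\lambda,\mu]}(\mathbf x,\mathbf y)$$ in $K[\mathbf x,\mathbf y]$. -/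

import Mathlib

open scoped BigOperators TensorProduct

noncomputable section

namespace QBoson

variable {K : Type*} [Field K]

/-! ### The one-dimensional Fock space of the q-boson algebra -/

/-- The Fock space with basis `|n⟩ = Finsupp.single n 1`, `n = 0, 1, 2, …`. -/
abbrev Fock (K : Type*) [Field K] : Type _ := ℕ →₀ K

/-- The basis vector `|n⟩`. -/
def ket (K : Type*) [Field K] (n : ℕ) : Fock K := Finsupp.single n 1

/-- `[n] = (1 - t ^ n) / (1 - t)`; the deformation parameter of the bosons is called `t`. -/
def qInt (t : K) (n : ℕ) : K := (1 - t ^ n) / (1 - t)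

/-- The creation operator, `|n⟩ ↦ |n + 1⟩`. -/
def creation (K : Type*) [Field K] : Module.End K (Fock K) :=
  Finsupp.linearCombination K fun n => ket K (n + 1)

/-- The annihilation operator, `|n⟩ ↦ [n] |n - 1⟩` (so `|0⟩ ↦ 0`, since `[0] = 0`). -/
def annihilation (t : K) : Module.End K (Fock K) :=
  Finsupp.linearCombination K fun n => qInt t n • ket K (n - 1)

/-! ### Chains of Fock spaces and the two-site space -/

/-- `M + 1` copies of the Fock space, with energies `0, …, M`. -/
abbrev Chain (K : Type*) [Field K] (M : ℕ) : Type _ := ⨂[K] _ : Fin (M + 1), Fock K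

/-- The operator that acts as `f` in the `i`th tensor factor and identically in the others. -/
def atSite {M : ℕ} (i : Fin (M + 1)) (f : Module.End K (Fock K)) : Module.End K (Chain K M) :=
  PiTensorProduct.map (Function.update (fun _ => LinearMap.id) i f)

/-- The full space `𝓕 = 𝓕⁽¹⁾ ⊗ 𝓕⁽²⁾`. -/
abbrev TwoSite (K : Type*) [Field K] (M₁ M₂ : ℕ) : Type _ := Chain K M₁ ⊗[K] Chain K M₂

/-- `f` at the `i`th place of the first chain. -/
def atSite₁ {M₁ : ℕ} (M₂ : ℕ) (f : Module.End K (Fock K)) (i : Fin (M₁ + 1)) :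
    Module.End K (TwoSite K M₁ M₂) :=
  TensorProduct.map (atSite i f) LinearMap.id

/-- `f` at the `i`th place of the second chain. -/
def atSite₂ (M₁ : ℕ) {M₂ : ℕ} (f : Module.End K (Fock K)) (i : Fin (M₂ + 1)) :
    Module.End K (TwoSite K M₁ M₂) :=
  TensorProduct.map LinearMap.id (atSite i f)

/-- The vector `⨂ |nᵢ⟩⁽¹⁾ ⊗ ⨂ |mᵢ⟩⁽²⁾`. -/
def state (K : Type*) [Field K] {M₁ M₂ : ℕ} (n : Fin (M₁ + 1) → ℕ) (m : Fin (M₂ + 1) → ℕ) :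
    TwoSite K M₁ M₂ :=
  (⨂ₜ[K] i, ket K (n i)) ⊗ₜ[K] (⨂ₜ[K] i, ket K (m i))

/-- The basis of the two-site space that consists of the vectors `state K n m`. -/
def stateBasis (K : Type*) [Field K] (M₁ M₂ : ℕ) :
    Module.Basis ((Fin (M₁ + 1) → ℕ) × (Fin (M₂ + 1) → ℕ)) K (TwoSite K M₁ M₂) :=
  (Basis.piTensorProduct fun _ : Fin (M₁ + 1) => Finsupp.basisSingleOne (R := K) (ι := ℕ)).tensorProduct
    (Basis.piTensorProduct fun _ : Fin (M₂ + 1) => Finsupp.basisSingleOne (R := K) (ι := ℕ))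

theorem stateBasis_apply {M₁ M₂ : ℕ} (n : Fin (M₁ + 1) → ℕ) (m : Fin (M₂ + 1) → ℕ) :
    stateBasis K M₁ M₂ (n, m) = state K n m := by
  simp [stateBasis, state, ket, Module.Basis.tensorProduct_apply, Basis.piTensorProduct_apply]

/-! ### Monodromy matrices and creation operators -/

/-- The `L`-matrix `!![u⁻¹, B†; (1 - t) B, u]` for given operators `B†` and `B`. -/
def lMatrix {V : Type*} [AddCommMonoid V] [Module K V]
    (t u : K) (Bd B : Module.End K V) :
    Matrix (Fin 2) (Fin 2) (Module.End K V) :=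
  !![u⁻¹ • 1, Bd; (1 - t) • B, u • 1]

/-- `T₁(u) = L⁽¹⁾_{M₁}(u) ⋯ L⁽¹⁾₀(u)`. -/
def monodromy₁ (t : K) (M₁ M₂ : ℕ) (u : K) :
    Matrix (Fin 2) (Fin 2) (Module.End K (TwoSite K M₁ M₂)) :=
  ((List.finRange (M₁ + 1)).reverse.map fun i =>
    lMatrix t u (atSite₁ M₂ (creation K) i) (atSite₁ M₂ (annihilation t) i)).prod

/-- `T₂(u) = L⁽²⁾_{M₂}(u) ⋯ L⁽²⁾₀(u)`. -/
def monodromy₂ (t : K) (M₁ M₂ : ℕ) (u : K) :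
    Matrix (Fin 2) (Fin 2) (Module.End K (TwoSite K M₁ M₂)) :=
  ((List.finRange (M₂ + 1)).reverse.map fun i =>
    lMatrix t u (atSite₂ M₁ (creation K) i) (atSite₂ M₁ (annihilation t) i)).prod

/-- The creation operator `B₁(u)`, the upper right entry of `T₁(u)`. -/
def B₁ (t : K) (M₁ M₂ : ℕ) (u : K) : Module.End K (TwoSite K M₁ M₂) := monodromy₁ t M₁ M₂ u 0 1

/-- The creation operator `B₂(u)`, the upper right entry of `T₂(u)`. -/
def B₂ (t : K) (M₁ M₂ : ℕ) (u : K) : Module.End K (TwoSite K M₁ M₂) := monodromy₂ t M₁ M₂ u 0 1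

/-- `∏ⱼ B₂(uⱼ) B₁(uⱼ) |0⟩`, the factors being ordered from left to right. -/
def psiTilde (t : K) (M₁ M₂ : ℕ) {N : ℕ} (u : Fin N → K) : TwoSite K M₁ M₂ :=
  (List.ofFn fun j => B₂ t M₁ M₂ (u j) * B₁ t M₁ M₂ (u j)).prod
    (state K (fun _ => 0) (fun _ => 0))

/-! ### Young diagrams -/

theorem finite_box (N M : ℕ) : {l : YoungDiagram | l.colLen 0 ≤ N ∧ l.rowLen 0 ≤ M}.Finite := by
  refine Set.Finite.of_finite_image (f := YoungDiagram.cells)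
    ((Finset.finite_toSet (Finset.range N ×ˢ Finset.range M).powerset).subset ?_)
    (fun a _ b _ h => YoungDiagram.ext h)
  rintro _ ⟨l, ⟨h₁, h₂⟩, rfl⟩
  simp only [Finset.coe_powerset, Set.mem_preimage, Set.mem_powerset_iff, Finset.coe_subset]
  rintro ⟨i, j⟩ h
  have hi := YoungDiagram.mem_iff_lt_colLen.mp ((YoungDiagram.mem_cells _).mp h)
  have hj := YoungDiagram.mem_iff_lt_rowLen.mp ((YoungDiagram.mem_cells _).mp h)
  have := l.colLen_anti 0 j (Nat.zero_le _)
  have := l.rowLen_anti 0 i (Nat.zero_le _)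
  simp only [Finset.mem_product, Finset.mem_range]
  omega

/-- The Young diagrams with at most `N` rows and at most `M` columns. -/
def box (N M : ℕ) : Finset YoungDiagram := (finite_box N M).toFinset

/-- The number of times `i` occurs among the first `N` row lengths `l₁, …, l_N` of `l`
(zeros included). For `i ≥ 1` and `l` with at most `N` rows this is the multiplicity of the part
`i` in `l`; for `i = 0` it is `N` minus the number of rows. -/
def mult (N : ℕ) (l : YoungDiagram) (i : ℕ) : ℕ := {r ∈ Finset.range N | l.rowLen r = i}.card

/-- The occupation numbers `n₀, …, n_M` of the `N`-particle state of `l = 1^{n₁} 2^{n₂} ⋯`. -/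
def occupation (N M : ℕ) (l : YoungDiagram) : Fin (M + 1) → ℕ := fun i => mult N l i

/-- The Young diagram `1^{n₁} 2^{n₂} ⋯ M^{n_M}`. -/
def diagramOf {M : ℕ} (n : Fin (M + 1) → ℕ) : YoungDiagram :=
  YoungDiagram.ofRowLens
    ((∑ i : Fin M, Multiset.replicate (n i.succ) ((i : ℕ) + 1)).sort (· ≥ ·))
    (Multiset.pairwise_sort _ _).sortedGE

/-! ### Hall-Littlewood polynomials -/

/-- `v_m(t) = ∏_{i=1}^m (1 - t^i) / (1 - t)`. -/
def vFactor (t : K) (m : ℕ) : K := ∏ i ∈ Finset.Icc 1 m, (1 - t ^ i) / (1 - t)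

/-- `v_l(t) = ∏_{i ≥ 0} v_{m_i}(t)` for `l` with `N` (possibly zero) parts. -/
def vDiagram (t : K) (N : ℕ) (l : YoungDiagram) : K :=
  ∏ i ∈ Finset.range (l.rowLen 0 + 1), vFactor t (mult N l i)

/-- The field of rational functions in `x₁, …, x_N`. -/
abbrev RatFun (K : Type*) [Field K] (N : ℕ) : Type _ := FractionRing (MvPolynomial (Fin N) K)

/-- The variable `xᵢ` as a rational function. -/
def ratVar (K : Type*) [Field K] {N : ℕ} (i : Fin N) : RatFun K N :=
  algebraMap (MvPolynomial (Fin N) K) (RatFun K N) (MvPolynomial.X i)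

/-- The scalar `c` as a rational function. -/
def ratConst (N : ℕ) (c : K) : RatFun K N :=
  algebraMap (MvPolynomial (Fin N) K) (RatFun K N) (MvPolynomial.C c)

/-- The pairs `i < j` in `{1, …, n}`. -/
def ltPairs (n : ℕ) : Finset (Fin n × Fin n) := {p | p.1 < p.2}

/-- `v_l(t)⁻¹ ∑_{w ∈ S_N} w (x₁^{l₁} ⋯ x_N^{l_N} ∏_{i<j} (xᵢ - t xⱼ) / (xᵢ - xⱼ))`. -/
def hallLittlewoodRat (t : K) (N : ℕ) (l : YoungDiagram) : RatFun K N :=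
  ratConst N (vDiagram t N l)⁻¹ * ∑ w : Equiv.Perm (Fin N),
    (∏ i : Fin N, ratVar K (w i) ^ l.rowLen i) *
      ∏ p ∈ ltPairs N,
        (ratVar K (w p.1) - ratConst N t * ratVar K (w p.2)) / (ratVar K (w p.1) - ratVar K (w p.2))

section Existence

open MvPolynomial

/-- The substitution `x_a ↦ x_b`. -/
def merge (K : Type*) [Field K] {N : ℕ} (a b : Fin N) :
    MvPolynomial (Fin N) K →ₐ[K] MvPolynomial (Fin N) K :=
  aeval fun k => if k = a then X b else X k

theorem dvd_sub_merge {N : ℕ} (a b : Fin N) (p : MvPolynomial (Fin N) K) :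
    X a - X b ∣ p - merge K a b p := by
  have h : (Ideal.Quotient.mkₐ K (Ideal.span {(X a - X b : MvPolynomial (Fin N) K)})).comp
      (merge K a b) = Ideal.Quotient.mkₐ K (Ideal.span {(X a - X b : MvPolynomial (Fin N) K)}) := by
    refine MvPolynomial.algHom_ext fun k => ?_
    simp only [merge, AlgHom.comp_apply, aeval_X, Ideal.Quotient.mkₐ_eq_mk]
    split_ifs with hk
    · subst hk
      rw [eq_comm, Ideal.Quotient.eq]
      exact Ideal.mem_span_singleton_self _
    · rfl
  have h' := DFunLike.congr_fun h p
  simp only [AlgHom.comp_apply, Ideal.Quotient.mkₐ_eq_mk] at h'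
  rw [eq_comm, Ideal.Quotient.eq] at h'
  exact Ideal.mem_span_singleton.mp h'

theorem sub_dvd_iff {N : ℕ} (a b : Fin N) (p : MvPolynomial (Fin N) K) :
    X a - X b ∣ p ↔ merge K a b p = 0 := by
  constructor
  · rintro ⟨q, rfl⟩
    have : merge K a b (X a - X b) = 0 := by
      simp [merge]
    rw [map_mul, this, zero_mul]
  · intro h
    simpa [h] using dvd_sub_merge a b p

theorem prime_sub {N : ℕ} {a b : Fin N} (hab : a ≠ b) :
    Prime (X a - X b : MvPolynomial (Fin N) K) := by
  refine ⟨sub_ne_zero.mpr fun h => hab (X_injective h), fun h => ?_, fun p q h => ?_⟩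
  · have := (sub_dvd_iff a b (1 : MvPolynomial (Fin N) K)).mp h.dvd
    simp at this
  · simp only [sub_dvd_iff, map_mul, mul_eq_zero] at h ⊢
    exact h

theorem prod_sub_dvd {N : ℕ} {p : MvPolynomial (Fin N) K}
    (h : ∀ a b : Fin N, a < b → X a - X b ∣ p) :
    ∏ q ∈ ltPairs N, (X q.1 - X q.2 : MvPolynomial (Fin N) K) ∣ p := by
  refine Finset.prod_dvd_of_isRelPrime ?_ fun q hq => h _ _ (by simpa [ltPairs] using hq)
  rintro ⟨a, b⟩ hq ⟨c, d⟩ hr hne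
  have hab : a < b := by simpa [ltPairs] using hq
  have hcd : c < d := by simpa [ltPairs] using hr
  refine ((prime_sub hab.ne).irreducible.isRelPrime_iff_not_dvd).mpr fun hd => hne ?_
  have h0 := (sub_dvd_iff a b _).mp hd
  simp only [merge, map_sub, aeval_X, sub_eq_zero] at h0
  split_ifs at h0 with h1 h2 h2
  · exact absurd (h1.trans h2.symm) hcd.ne
  · rw [h1, ← X_injective h0]
  · have := X_injective h0
    omega
  · exact absurd (X_injective h0) hcd.ne

/-- The symmetrized expression is a polynomial. -/
theorem exists_hallLittlewood (t : K) (N : ℕ) (l : YoungDiagram) :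
    ∃ p : MvPolynomial (Fin N) K,
      algebraMap (MvPolynomial (Fin N) K) (RatFun K N) p = hallLittlewoodRat t N l := by
  classical
  set term : Equiv.Perm (Fin N) → MvPolynomial (Fin N) K := fun w =>
    (∏ i : Fin N, X (w i) ^ l.rowLen i) * ∏ p ∈ ltPairs N, (X (w p.1) - C t * X (w p.2)) with hterm
  obtain ⟨g, hg⟩ : ∏ q ∈ ltPairs N, (X q.1 - X q.2 : MvPolynomial (Fin N) K) ∣
      ∑ w : Equiv.Perm (Fin N), (Equiv.Perm.sign w : ℤ) • term w := by
    refine prod_sub_dvd fun a b hab => (sub_dvd_iff a b _).mpr ?_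
    rw [map_sum]
    refine Finset.sum_involution (fun w _ => Equiv.swap a b * w) (fun w _ => ?_) (fun w _ _ h => ?_)
      (fun _ _ => Finset.mem_univ _) (fun w _ => ?_)
    · have hX : ∀ k : Fin N, merge K a b (X (Equiv.swap a b k)) = merge K a b (X k) := by
        intro k
        simp only [merge, aeval_X, Equiv.swap_apply_def]
        split_ifs <;> simp_all
      have hT : merge K a b (term (Equiv.swap a b * w)) = merge K a b (term w) := by
        simp only [hterm, map_mul, map_prod, map_pow, map_sub, Equiv.Perm.mul_apply, hX]
      rw [map_zsmul, map_zsmul, hT, Equiv.Perm.sign_mul, Equiv.Perm.sign_swap hab.ne]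
      simp
    · have := mul_eq_right.mp h
      exact hab.ne (Equiv.swap_eq_one_iff.mp this)
    · simp
  refine ⟨C (vDiagram t N l)⁻¹ * g, ?_⟩
  rw [hallLittlewoodRat, map_mul, ratConst]
  congr 1
  set φ := algebraMap (MvPolynomial (Fin N) K) (RatFun K N) with hφ
  have hinj : Function.Injective φ := IsFractionRing.injective _ _
  have hv : ∏ q ∈ ltPairs N, (ratVar K q.1 - ratVar K q.2 : RatFun K N) ≠ 0 := by
    refine Finset.prod_ne_zero_iff.mpr fun q hq => sub_ne_zero.mpr fun h => ?_
    have : q.1 < q.2 := by simpa [ltPairs] using hq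
    exact this.ne (X_injective (hinj h))
  have hsign : ∀ w : Equiv.Perm (Fin N),
      ∏ q ∈ ltPairs N, (ratVar K (w q.1) - ratVar K (w q.2) : RatFun K N) =
        (Equiv.Perm.sign w : ℤ) • ∏ q ∈ ltPairs N, (ratVar K q.1 - ratVar K q.2 : RatFun K N) := by
    intro w
    have h1 := Matrix.det_permute' w (Matrix.vandermonde (fun i : Fin N => (ratVar K i : RatFun K N))).transpose
    have h2 : (Matrix.vandermonde (fun i : Fin N => (ratVar K i : RatFun K N))).transpose.submatrix id w
        = (Matrix.vandermonde (fun i : Fin N => (ratVar K (w i) : RatFun K N))).transpose := by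
      ext i j
      simp [Matrix.vandermonde]
    rw [h2, Matrix.det_transpose, Matrix.det_transpose, Matrix.det_vandermonde,
      Matrix.det_vandermonde] at h1
    have conv : ∀ f : Fin N → RatFun K N, ∏ q ∈ ltPairs N, (f q.1 - f q.2) =
        (∏ q ∈ ltPairs N, (-1 : RatFun K N)) * ∏ i : Fin N, ∏ j ∈ Finset.Ioi i, (f j - f i) := by
      intro f
      have : ∏ i : Fin N, ∏ j ∈ Finset.Ioi i, (f j - f i) = ∏ q ∈ ltPairs N, (f q.2 - f q.1) := by
        rw [Finset.prod_sigma', ltPairs]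
        refine Finset.prod_bij' (fun x _ => (x.1, x.2)) (fun x _ => ⟨x.1, x.2⟩) ?_ ?_ ?_ ?_ ?_ <;>
          simp
      rw [this, ← Finset.prod_mul_distrib]
      refine Finset.prod_congr rfl fun q _ => by ring
    rw [conv (fun i => ratVar K (w i)), conv (fun i => ratVar K i), h1]
    simp only [zsmul_eq_mul]
    ring
  have hg' := congrArg φ hg
  rw [map_mul, map_prod] at hg'
  have hg2 : φ g * ∏ q ∈ ltPairs N, (ratVar K q.1 - ratVar K q.2 : RatFun K N) =
      φ (∑ w : Equiv.Perm (Fin N), (Equiv.Perm.sign w : ℤ) • term w) := by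
    rw [hg', mul_comm]
    simp only [map_sub]
    rfl
  rw [eq_comm, ← mul_left_inj' hv, hg2, map_sum, Finset.sum_mul]
  refine Finset.sum_congr rfl fun w _ => ?_
  rw [Finset.prod_div_distrib, hsign, map_zsmul]
  have hs : ((Equiv.Perm.sign w : ℤ) : RatFun K N) * ((Equiv.Perm.sign w : ℤ) : RatFun K N) = 1 := by
    rcases Int.units_eq_one_or (Equiv.Perm.sign w) with h | h <;> simp [h]
  have hs0 : ((Equiv.Perm.sign w : ℤ) : RatFun K N) ≠ 0 := left_ne_zero_of_mul_eq_one hs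
  simp only [hterm, map_mul, map_prod, map_pow, map_sub, zsmul_eq_mul, ratVar, ratConst] at hs hs0 hv ⊢
  field_simp
  rw [pow_two, hs, one_mul]

end Existence

/-- The Hall-Littlewood polynomial `P_l(x₁, …, x_N; t)` of a Young diagram with at most `N` rows:
the polynomial that is equal to the symmetrized expression `hallLittlewoodRat t N l`. -/
def hallLittlewoodP (t : K) (N : ℕ) (l : YoungDiagram) : MvPolynomial (Fin N) K :=
  (exists_hallLittlewood t N l).choose

theorem hallLittlewoodP_spec (t : K) (N : ℕ) (l : YoungDiagram) :
    algebraMap (MvPolynomial (Fin N) K) (RatFun K N) (hallLittlewoodP t N l) =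
      hallLittlewoodRat t N l :=
  (exists_hallLittlewood t N l).choose_spec

/-! ### Coupled Hall-Littlewood functions -/

/-- The polynomial ring `K[x₁, x₂, …, y₁, y₂, …]`; `Sum.inl n` stands for `x_n` and `Sum.inr n`
for `y_n`. -/
abbrev XY (K : Type*) [Field K] : Type _ := MvPolynomial (ℕ+ ⊕ ℕ+) K

/-- `ξ_t(𝐱, z) = ∑_{n ≥ 1} (1 - t^n) x_n z^n`. -/
def xi (t : K) (x : ℕ+ → XY K) : PowerSeries (XY K) :=
  PowerSeries.mk fun n => if h : 0 < n then MvPolynomial.C (1 - t ^ n) * x ⟨n, h⟩ else 0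

variable [CharZero K]

/-- `q_n(𝐱)`, the coefficient of `z^n` in `exp (ξ_t(𝐱, z))`, and `0` for `n < 0`. -/
def qPoly (t : K) (x : ℕ+ → XY K) (n : ℤ) : XY K :=
  if 0 ≤ n then PowerSeries.coeff n.toNat ((PowerSeries.exp (XY K)).subst (xi t x)) else 0

/-- `q_{[a, b]}(𝐱, 𝐲) = ∏ᵢ q_{aᵢ}(𝐱) ∏ⱼ q_{bⱼ}(𝐲)` for sequences of integers. -/
def qPair (t : K) {r s : ℕ} (a : Fin r → ℤ) (b : Fin s → ℤ) : XY K :=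
  (∏ i, qPoly t (fun n => MvPolynomial.X (Sum.inl n)) (a i)) *
    ∏ j, qPoly t (fun n => MvPolynomial.X (Sum.inr n)) (b j)

/-- The coefficient of `R^k` in the expansion of `(1 - R) / (1 - t R)`. -/
def coeffR (t : K) (k : ℕ) : K :=
  PowerSeries.coeff k ((1 - PowerSeries.X) * (1 - PowerSeries.C t * PowerSeries.X)⁻¹)

/-- The coefficient of `D^k` in the expansion of `(1 - D) (1 - t² D) / (1 - t D)²`. -/
def coeffD (t : K) (k : ℕ) : K :=
  PowerSeries.coeff k ((1 - PowerSeries.X) * (1 - PowerSeries.C t * PowerSeries.X)⁻¹ *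
    ((1 - PowerSeries.C (t ^ 2) * PowerSeries.X) * (1 - PowerSeries.C t * PowerSeries.X)⁻¹))

/-- The change of the `i`th entry of an integer sequence under `∏_{p < q} R_{pq}^{k_{pq}}`, where
`R_{pq}` raises the `p`th entry by `1` and lowers the `q`th entry by `1`. -/
def shiftR {r : ℕ} (k : ltPairs r → ℕ) (i : Fin r) : ℤ :=
  ∑ p, (k p : ℤ) * ((if p.1.1 = i then 1 else 0) - (if p.1.2 = i then 1 else 0))

/-- The exponents of the operators `R_{λᵢλⱼ}` (`i < j`), `R_{μₐμ_b}` (`a < b`) and `D_{λᵢμₐ}`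
in a monomial. -/
abbrev Exponents (r s : ℕ) : Type := (ltPairs r → ℕ) × (ltPairs s → ℕ) × (Fin r × Fin s → ℕ)

/-- The term of the expansion of the product of the raising operators with exponents `e`,
applied to `q_{[a, b]}`. -/
def coupledTerm (t : K) {r s : ℕ} (a : Fin r → ℤ) (b : Fin s → ℤ) (e : Exponents r s) : XY K :=
  ((∏ p, coeffR t (e.1 p)) * (∏ p, coeffR t (e.2.1 p)) * ∏ p, coeffD t (e.2.2 p)) •
    qPair t (fun i => a i + shiftR e.1 i - ∑ j, (e.2.2 (i, j) : ℤ))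
      (fun j => b j + shiftR e.2.1 j - ∑ i, (e.2.2 (i, j) : ℤ))

theorem sum_mul_shiftR_le {r : ℕ} (k : ltPairs r → ℕ) :
    ∑ i : Fin r, ((i : ℤ) + 1) * shiftR k i ≤ - ∑ p, (k p : ℤ) := by
  simp only [shiftR, Finset.mul_sum]
  rw [Finset.sum_comm, ← Finset.sum_neg_distrib]
  refine Finset.sum_le_sum fun p _ => ?_
  have hp : p.1.1 < p.1.2 := by simpa [ltPairs] using p.2
  have : ∑ i : Fin r, ((i : ℤ) + 1) *
      ((k p : ℤ) * ((if p.1.1 = i then 1 else 0) - (if p.1.2 = i then 1 else 0))) =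
      (k p : ℤ) * (((p.1.1 : ℕ) : ℤ) - ((p.1.2 : ℕ) : ℤ)) := by
    have e : ∀ i : Fin r, ((i : ℤ) + 1) *
        ((k p : ℤ) * ((if p.1.1 = i then 1 else 0) - (if p.1.2 = i then 1 else 0))) =
        (if p.1.1 = i then (k p : ℤ) * ((i : ℤ) + 1) else 0) -
          (if p.1.2 = i then (k p : ℤ) * ((i : ℤ) + 1) else 0) := by
      intro i
      split_ifs <;> ring
    simp only [e, Finset.sum_sub_distrib, Finset.sum_ite_eq, Finset.mem_univ, if_true]
    ring
  rw [this]
  have h : (((p.1.1 : ℕ) : ℤ) - ((p.1.2 : ℕ) : ℤ)) ≤ -1 := by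
    have : (p.1.1 : ℕ) < (p.1.2 : ℕ) := hp
    omega
  nlinarith [Int.natCast_nonneg (k p)]

theorem exponents_le {r s : ℕ} (a : Fin r → ℤ) (k : ltPairs r → ℕ) (d : Fin r → Fin s → ℕ)
    (h : ∀ i, 0 ≤ a i + shiftR k i - ∑ j, (d i j : ℤ)) :
    ∑ p, (k p : ℤ) + ∑ i, ∑ j, (d i j : ℤ) ≤ ∑ i : Fin r, ((i : ℤ) + 1) * a i := by
  have h1 : 0 ≤ ∑ i : Fin r, ((i : ℤ) + 1) * (a i + shiftR k i - ∑ j, (d i j : ℤ)) :=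
    Finset.sum_nonneg fun i _ => mul_nonneg (by positivity) (h i)
  have h2 : ∑ i : Fin r, ((i : ℤ) + 1) * (a i + shiftR k i - ∑ j, (d i j : ℤ)) =
      ∑ i : Fin r, ((i : ℤ) + 1) * a i + ∑ i : Fin r, ((i : ℤ) + 1) * shiftR k i -
        ∑ i : Fin r, ((i : ℤ) + 1) * ∑ j, (d i j : ℤ) := by
    rw [← Finset.sum_add_distrib, ← Finset.sum_sub_distrib]
    exact Finset.sum_congr rfl fun i _ => by ring
  have h3 : ∑ i, ∑ j, (d i j : ℤ) ≤ ∑ i : Fin r, ((i : ℤ) + 1) * ∑ j, (d i j : ℤ) := by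
    refine Finset.sum_le_sum fun i _ => ?_
    have : 0 ≤ ∑ j, (d i j : ℤ) := Finset.sum_nonneg fun j _ => by positivity
    nlinarith [Int.natCast_nonneg (i : ℕ)]
  have h4 := sum_mul_shiftR_le k
  linarith

/-- Only finitely many terms of the expansion are nonzero. -/
theorem finite_support_coupledTerm (t : K) {r s : ℕ} (a : Fin r → ℤ) (b : Fin s → ℤ) :
    (Function.support (coupledTerm t a b)).Finite := by
  set A : ℕ := (∑ i : Fin r, ((i : ℤ) + 1) * a i).toNat with hA
  set B : ℕ := (∑ i : Fin s, ((i : ℤ) + 1) * b i).toNat with hB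
  refine ((Set.finite_Iic (fun _ => A : ltPairs r → ℕ)).prod
    ((Set.finite_Iic (fun _ => B : ltPairs s → ℕ)).prod
      (Set.finite_Iic (fun _ => A : Fin r × Fin s → ℕ)))).subset ?_
  rintro ⟨k, k', d⟩ h
  have hq : qPair t (fun i => a i + shiftR k i - ∑ j, (d (i, j) : ℤ))
      (fun j => b j + shiftR k' j - ∑ i, (d (i, j) : ℤ)) ≠ 0 := fun h0 =>
    h (by simp only [coupledTerm, h0, smul_zero])
  have h1 := exponents_le a k (fun i j => d (i, j)) fun i => by
    by_contra hc
    refine hq ?_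
    rw [qPair, Finset.prod_eq_zero (Finset.mem_univ i) (by rw [qPoly, if_neg hc]), zero_mul]
  have h2 := exponents_le b k' (fun j i => d (i, j)) fun i => by
    by_contra hc
    refine hq ?_
    rw [qPair, Finset.prod_eq_zero (s := Finset.univ) (i := i) (f := fun j => qPoly t _ _)
      (Finset.mem_univ i) (by rw [qPoly, if_neg hc]), mul_zero]
  have hd : 0 ≤ ∑ i, ∑ j, (d (i, j) : ℤ) := by positivity
  have hd' : 0 ≤ ∑ j, ∑ i, (d (i, j) : ℤ) := by positivity
  have hk : 0 ≤ ∑ p, (k p : ℤ) := by positivity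
  refine ⟨fun p => ?_, fun p => ?_, fun p => ?_⟩
  · have := Finset.single_le_sum (f := fun p => (k p : ℤ)) (fun _ _ => by positivity)
      (Finset.mem_univ p)
    simp only at this ⊢
    omega
  · have := Finset.single_le_sum (f := fun p => (k' p : ℤ)) (fun _ _ => by positivity)
      (Finset.mem_univ p)
    simp only at this ⊢
    omega
  · have e1 := Finset.single_le_sum (f := fun i => ∑ j, (d (i, j) : ℤ))
      (fun _ _ => by positivity) (Finset.mem_univ p.1)
    have e2 := Finset.single_le_sum (f := fun j => (d (p.1, j) : ℤ))
      (fun _ _ => by positivity) (Finset.mem_univ p.2)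
    simp only [Prod.mk.eta] at e1 e2 ⊢
    omega

/-- The coupled Hall-Littlewood function `Q_{[l, m]}(𝐱, 𝐲)`, i.e.
`∏_{i<j} (1 - R_{lᵢlⱼ}) / (1 - t R_{lᵢlⱼ}) ∏_{a<b} (1 - R_{mₐm_b}) / (1 - t R_{mₐm_b})
∏_{i,a} (1 - D_{lᵢmₐ}) (1 - t² D_{lᵢmₐ}) / (1 - t D_{lᵢmₐ})²` applied to `q_{[l, m]}(𝐱, 𝐲)`,
as a finite sum over the terms of the expansion. -/
def coupledQ (t : K) (l m : YoungDiagram) : XY K :=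
  ∑ᶠ e, coupledTerm t (fun i : Fin (l.colLen 0) => (l.rowLen i : ℤ))
    (fun j : Fin (m.colLen 0) => (m.rowLen j : ℤ)) e

/-- The linear map from the two-site space to `K[𝐱, 𝐲]` that sends `⨂ |nᵢ⟩⁽¹⁾ ⊗ ⨂ |mᵢ⟩⁽²⁾` to
`Q_{[l, m]}` with `l = 1^{n₁} 2^{n₂} ⋯` and `m = 1^{m₁} 2^{m₂} ⋯`. -/
def jMap (t : K) (M₁ M₂ : ℕ) : TwoSite K M₁ M₂ →ₗ[K] XY K :=
  (stateBasis K M₁ M₂).constr K fun p => coupledQ t (diagramOf p.1) (diagramOf p.2)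

theorem jMap_state (t : K) {M₁ M₂ : ℕ} (n : Fin (M₁ + 1) → ℕ) (m : Fin (M₂ + 1) → ℕ) :
    jMap t M₁ M₂ (state K n m) = coupledQ t (diagramOf n) (diagramOf m) := by
  rw [← stateBasis_apply, jMap, Module.Basis.constr_basis]

end QBoson

end

/-! The two monodromies act on different tensor factors, so the vector is the tensor product of two
one-chain vectors, and everything reduces to one chain. There `B†` at site `k` becomes
multiplication by `X_k` on a polynomial ring. The right column of the monodromy is closed under left
multiplication by an `L`-matrix; up to powers of `u` it depends only on `x = u ^ 2`, which gives the
recursion `modelBD`.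

The one-chain vector has an explicit form, `bethe`: choose the set of rapidities sitting at the top
site, weight it by `x_i ^ k` and by one factor `(x_i - t x_j) / (x_i - x_j)` for each `j` left
below, and recurse. `modelBD_bethe` shows by induction on the number of sites that `B(x_a)` inserts
`a` into this state. The induction needs the action of `D(x_a)` as well: a diagonal term plus terms
in which `a` replaces an existing rapidity. The required rational identities all come from one
partial fraction expansion, `prod_hlFactor_left`.

Splitting the Hall-Littlewood symmetrization by which variables receive equal exponents gives the
same recursion, each block of `m` equal exponents contributing `v_m(t)`
(`symmetrized_replicate_append`). Hence the coefficients of `bethe` are the `P_λ`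
(`coeff_bethe_mul`).

These arguments divide by `x_i - x_j` and need `x_i ≠ t x_j`, whereas the given `u_j` may violate
both. They are therefore run with indeterminate rapidities in a fraction field; the outcome is an
identity of polynomials and can be specialized (`coeff_genericPsi`, `modelPsi_eq_map_genericPsi`).
The formula for the image under `jMap` follows by linearity, since occupation numbers determine the
diagram. -/

noncomputable section

namespace QBoson

open Finset

/-! ### Partial fraction identities for Hall-Littlewood factors -/

section Identities

variable {L ι : Type*} [Field L] [DecidableEq ι]

/-- The factor `(y - t z) / (y - z)` of the Hall-Littlewood symmetrization. -/
def hlFactor (t y z : L) : L := (y - t * z) / (y - z)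

/-- Partial fractions in `z`: the product tends to `1` at infinity and has simple poles at the `x
k`. Algebraically, this is Lagrange interpolation at the poles. -/
theorem prod_hlFactor_left (t : L) (x : ι → L) (hx : Function.Injective x) (z : L) (T : Finset ι)
    (hz : ∀ i ∈ T, z ≠ x i) :
    ∏ i ∈ T, hlFactor t z (x i) =
      1 + ∑ k ∈ T, (1 - t) * x k / (z - x k) * ∏ i ∈ T.erase k, hlFactor t (x k) (x i) := by
  classical
  -- Numerator minus denominator: both are monic of degree `T.card`, so the difference has smaller
  -- degree and is determined by its values at the nodes.
  set p : Polynomial L := ∏ i ∈ T, (Polynomial.X - Polynomial.C (t * x i)) -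
    ∏ i ∈ T, (Polynomial.X - Polynomial.C (x i)) with hp
  have hdeg : p.degree < T.card := by
    rcases T.eq_empty_or_nonempty with rfl | hT
    · simp [hp]
    have h1 : (∏ i ∈ T, (Polynomial.X - Polynomial.C (t * x i))).degree = ((T.card : ℕ) : WithBot ℕ) := by
      simp only [Polynomial.degree_prod, Polynomial.degree_X_sub_C]
      simp
    have h2 : (∏ i ∈ T, (Polynomial.X - Polynomial.C (x i))).degree = ((T.card : ℕ) : WithBot ℕ) := by
      simp [Polynomial.degree_prod]
    rw [← h1]
    refine Polynomial.degree_sub_lt_left (h1.trans h2.symm) ?_ ?_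
    · exact (Polynomial.monic_prod_of_monic _ _ fun i _ => Polynomial.monic_X_sub_C _).ne_zero
    · rw [(Polynomial.monic_prod_of_monic _ _ fun i _ => Polynomial.monic_X_sub_C _).leadingCoeff,
        (Polynomial.monic_prod_of_monic _ _ fun i _ => Polynomial.monic_X_sub_C _).leadingCoeff]
  have hint := Lagrange.eq_interpolate (v := x) hx.injOn hdeg
  have hev := congrArg (Polynomial.eval z) hint
  rw [Lagrange.interpolate_apply, Polynomial.eval_finsetSum] at hev
  have hz0 : ∏ i ∈ T, (z - x i) ≠ 0 := prod_ne_zero_iff.mpr fun i hi => sub_ne_zero.mpr (hz i hi)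
  have hl : ∏ i ∈ T, hlFactor t z (x i) = 1 + Polynomial.eval z p / ∏ i ∈ T, (z - x i) := by
    simp only [hlFactor, prod_div_distrib]
    rw [eq_comm, ← div_self hz0, ← add_div]
    congr 1
    simp [hp, Polynomial.eval_prod]
  rw [hl, hev, sum_div]
  congr 1
  refine sum_congr rfl fun k hk => ?_
  have hpk : Polynomial.eval (x k) p = (1 - t) * x k * ∏ i ∈ T.erase k, (x k - t * x i) := by
    have h0 : ∏ i ∈ T, (x k - x i) = 0 := prod_eq_zero hk (sub_self _)
    simp only [hp, Polynomial.eval_sub, Polynomial.eval_prod, Polynomial.eval_X,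
      Polynomial.eval_C, h0, sub_zero]
    rw [← mul_prod_erase _ _ hk]
    ring
  have hzk : z - x k ≠ 0 := sub_ne_zero.mpr (hz k hk)
  have he : ∏ i ∈ T.erase k, (z - x i) ≠ 0 :=
    prod_ne_zero_iff.mpr fun i hi => sub_ne_zero.mpr (hz i (mem_of_mem_erase hi))
  have hk0 : ∏ i ∈ T.erase k, (x k - x i) ≠ 0 :=
    prod_ne_zero_iff.mpr fun i hi => sub_ne_zero.mpr fun h => ne_of_mem_erase hi (hx h).symm
  rw [Polynomial.eval_mul, Polynomial.eval_C, hpk, Lagrange.basis, Polynomial.eval_prod,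
    ← mul_prod_erase _ _ hk]
  have hb : ∀ i ∈ T.erase k, Polynomial.eval z (Lagrange.basisDivisor (x k) (x i)) =
      (z - x i) / (x k - x i) := by
    intro i _
    simp [Lagrange.basisDivisor, div_eq_inv_mul]
  rw [prod_congr rfl hb]
  simp only [hlFactor, prod_div_distrib]
  field_simp

theorem hlFactor_inv (t : L) {y z : L} (hy : y ≠ 0) (hz : z ≠ 0) :
    hlFactor t y⁻¹ z⁻¹ = hlFactor t z y := by
  have h : y⁻¹ - t * z⁻¹ = (z - t * y) * (y * z)⁻¹ := by field_simp
  have h' : y⁻¹ - z⁻¹ = (z - y) * (y * z)⁻¹ := by field_simp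
  rw [hlFactor, hlFactor, h, h', mul_div_mul_right _ _ (inv_ne_zero (mul_ne_zero hy hz))]

theorem hlFactor_sub_one (t : L) {y z : L} (h : y ≠ z) :
    hlFactor t y z - 1 = (1 - t) * z / (y - z) := by
  have := sub_ne_zero.mpr h
  rw [hlFactor]
  field_simp
  ring

/-- Inverting all variables exchanges the two arguments of `hlFactor`, so this is the previous
expansion at `z⁻¹`. -/
theorem prod_hlFactor_right (t : L) (x : ι → L) (hx : Function.Injective x) (hx0 : ∀ i, x i ≠ 0)
    (z : L) (hz0 : z ≠ 0) (T : Finset ι) (hz : ∀ i ∈ T, z ≠ x i) :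
    ∏ i ∈ T, hlFactor t (x i) z =
      1 + ∑ k ∈ T, (hlFactor t (x k) z - 1) * ∏ i ∈ T.erase k, hlFactor t (x i) (x k) := by
  have := prod_hlFactor_left t (fun i => (x i)⁻¹) (fun i j h => hx (inv_injective h)) z⁻¹ T
    fun i hi h => hz i hi (inv_injective h)
  simp only [hlFactor_inv t hz0 (hx0 _), hlFactor_inv t (hx0 _) (hx0 _)] at this
  rw [this]
  congr 1
  refine sum_congr rfl fun k hk => ?_
  congr 1
  have h1 := sub_ne_zero.mpr (hz k hk).symm
  rw [hlFactor_sub_one t (hz k hk).symm]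
  have h' : z⁻¹ - (x k)⁻¹ = (x k - z) * (z * x k)⁻¹ := by
    have := hx0 k
    field_simp
  rw [h']
  have := hx0 k
  field_simp

/-- The expansion at `z = x a`, multiplied by `x a`: each partial fraction cancels the corresponding
term of the sum, by antisymmetry of `x a - x k`. -/
theorem prod_hlFactor_left' (t : L) (x : ι → L) (hx : Function.Injective x)
    (a : ι) (T : Finset ι) (ha : a ∉ T) :
    x a * ∏ i ∈ T, hlFactor t (x a) (x i) + ∑ k ∈ T, x k * (hlFactor t (x k) (x a) - 1) *
      ∏ i ∈ T.erase k, hlFactor t (x k) (x i) = x a := by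
  have hne : ∀ i ∈ T, x a ≠ x i := fun i hi h => ha (hx h ▸ hi)
  rw [prod_hlFactor_left t x hx (x a) T hne, mul_add, mul_one, add_assoc,
    add_eq_left, mul_sum, ← sum_add_distrib]
  refine sum_eq_zero fun k hk => ?_
  have h1 := sub_ne_zero.mpr (hne k hk)
  have h2 := sub_ne_zero.mpr (hne k hk).symm
  rw [hlFactor_sub_one t (hne k hk).symm, ← mul_assoc, ← add_mul]
  convert zero_mul _ using 2
  field_simp
  ring

/-- The expansion at `z = t * x a`, multiplied by `∏ hlFactor t (x i) (x a)`. The power of `t`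
arises because `hlFactor t (t * x a) (x i) * hlFactor t (x i) (x a) = t`. -/
theorem prod_hlFactor_sub_pow (t : L) (x : ι → L) (hx : Function.Injective x)
    (hxt : ∀ i j, i ≠ j → x i ≠ t * x j)
    (a : ι) (T : Finset ι) (ha : a ∉ T) :
    x a * (∏ i ∈ T, hlFactor t (x i) (x a) - t ^ T.card) =
      ∑ k ∈ T, x k * (hlFactor t (x k) (x a) - 1) * (∏ i ∈ T.erase k, hlFactor t (x k) (x i)) *
        ∏ i ∈ T.erase k, hlFactor t (x i) (x a) := by
  have hne : ∀ i ∈ T, x i ≠ x a := fun i hi h => ha (hx h ▸ hi)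
  have hne' : ∀ i ∈ T, x i ≠ t * x a := fun i hi => hxt i a fun h => ha (h ▸ hi)
  have key := prod_hlFactor_left t x hx (t * x a) T fun i hi => (hne' i hi).symm
  have h1 : (∏ i ∈ T, hlFactor t (t * x a) (x i)) * ∏ i ∈ T, hlFactor t (x i) (x a) =
      t ^ T.card := by
    rw [← prod_mul_distrib, ← prod_const]
    refine prod_congr rfl fun i hi => ?_
    have e1 := sub_ne_zero.mpr (hne i hi)
    have e2 := sub_ne_zero.mpr (hne' i hi)
    have e3 := sub_ne_zero.mpr (hne' i hi).symm
    simp only [hlFactor]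
    field_simp
    ring
  rw [← h1, key, add_mul, one_mul, sub_add_cancel_left, sum_mul, mul_neg, mul_sum,
    ← sum_neg_distrib]
  refine sum_congr rfl fun k hk => ?_
  rw [← mul_prod_erase _ (fun i => hlFactor t (x i) (x a)) hk, hlFactor_sub_one t (hne k hk)]
  have e1 := sub_ne_zero.mpr (hne k hk)
  have e2 := sub_ne_zero.mpr (hne' k hk)
  have e3 := sub_ne_zero.mpr (hne' k hk).symm
  have : (1 - t) * x k / (t * x a - x k) * hlFactor t (x k) (x a) =
      - (x k * ((1 - t) / (x k - x a))) := by
    simp only [hlFactor]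
    field_simp
    ring
  linear_combination (-(x a * (∏ i ∈ T.erase k, hlFactor t (x k) (x i)) *
        ∏ i ∈ T.erase k, hlFactor t (x i) (x a))) * this

/-- The expansion at `z = 0`, where every factor on the left equals `t`. -/
theorem sum_prod_hlFactor (t : L) (ht : t ≠ 1) (x : ι → L) (hx : Function.Injective x)
    (hx0 : ∀ i, x i ≠ 0) (T : Finset ι) :
    ∑ k ∈ T, ∏ i ∈ T.erase k, hlFactor t (x k) (x i) = qInt t T.card := by
  have key := prod_hlFactor_left t x hx 0 T fun i _ => (hx0 i).symm
  have h1 : ∏ i ∈ T, hlFactor t 0 (x i) = t ^ T.card := by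
    rw [← prod_const]
    refine prod_congr rfl fun i _ => ?_
    have := hx0 i
    simp only [hlFactor]
    field_simp
    ring
  have h2 : ∀ k ∈ T, (1 - t) * x k / (0 - x k) * ∏ i ∈ T.erase k, hlFactor t (x k) (x i) =
      -(1 - t) * ∏ i ∈ T.erase k, hlFactor t (x k) (x i) := by
    intro k _
    have := hx0 k
    field_simp
    ring
  rw [h1, sum_congr rfl h2, ← mul_sum] at key
  have := sub_ne_zero.mpr ht.symm
  rw [qInt, eq_div_iff this, key]
  ring

end Identities

/-! ### Polynomial model of the chain -/

section Model

variable {R : Type*} [CommRing R]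

/-- The operator `(1 - t) B` at the `k`th place, on the polynomial model of the Fock spaces in which
`B†` at the `k`th place is the multiplication by `X_k`. -/
def lowering (t : R) (k : ℕ) : Module.End R (MvPolynomial ℕ R) :=
  (MvPolynomial.basisMonomials ℕ R).constr R fun n =>
    MvPolynomial.monomial (n - Finsupp.single k 1) (1 - t ^ n k)

theorem lowering_monomial (t : R) (k : ℕ) (n : ℕ →₀ ℕ) (c : R) :
    lowering t k (MvPolynomial.monomial n c) =
      MvPolynomial.monomial (n - Finsupp.single k 1) (c * (1 - t ^ n k)) := by
  have : (MvPolynomial.monomial n c : MvPolynomial ℕ R) =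
      c • MvPolynomial.basisMonomials ℕ R n := by
    simp [MvPolynomial.smul_monomial]
  rw [this, map_smul, lowering, Module.Basis.constr_basis, MvPolynomial.smul_monomial, smul_eq_mul]

theorem lowering_X_mul_of_ne (t : R) {j k : ℕ} (h : j ≠ k) (p : MvPolynomial ℕ R) :
    lowering t k (MvPolynomial.X j * p) = MvPolynomial.X j * lowering t k p := by
  induction p using MvPolynomial.induction_on' with
  | monomial n c =>
    have h1 : (Finsupp.single j 1 + n) - Finsupp.single k 1 =
        Finsupp.single j 1 + (n - Finsupp.single k 1) := by
      ext i
      simp only [Finsupp.tsub_apply, Finsupp.add_apply, Finsupp.single_apply]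
      split_ifs <;> omega
    rw [MvPolynomial.X, MvPolynomial.monomial_mul, lowering_monomial, lowering_monomial,
      MvPolynomial.monomial_mul, h1, one_mul, one_mul]
    simp [h]
  | add p q hp hq => rw [mul_add, map_add, map_add, hp, hq, mul_add]

/-- The `q`-boson commutation relation between `(1 - t) B` and `B†` at one site. -/
theorem lowering_X_mul (t : R) (k : ℕ) (p : MvPolynomial ℕ R) :
    lowering t k (MvPolynomial.X k * p) =
      (1 - t) • p + t • (MvPolynomial.X k * lowering t k p) := by
  induction p using MvPolynomial.induction_on' with
  | monomial n c =>
    rw [MvPolynomial.X, MvPolynomial.monomial_mul, lowering_monomial, lowering_monomial,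
      MvPolynomial.monomial_mul, MvPolynomial.smul_monomial, MvPolynomial.smul_monomial]
    have h1 : Finsupp.single k 1 + n - Finsupp.single k 1 = n := by
      rw [add_comm, add_tsub_cancel_right]
    rw [h1]
    -- For `n k = 0` the truncated subtraction does nothing, but the coefficient `1 - t ^ 0`
    -- vanishes.
    rcases Nat.eq_zero_or_pos (n k) with h0 | h0
    · simp [h0, mul_comm]
    · have h2 : Finsupp.single k 1 + (n - Finsupp.single k 1) = n := by
        rw [add_tsub_cancel_of_le]
        exact Finsupp.single_le_iff.mpr h0
      rw [h2, ← map_add]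
      congr 1
      simp only [Finsupp.add_apply, Finsupp.single_eq_same, smul_eq_mul]
      ring
  | add p q hp hq =>
    rw [mul_add, map_add, map_add, hp, hq, mul_add]
    simp only [smul_add]
    abel

theorem lowering_X_pow_mul (t : R) (k m : ℕ) {p : MvPolynomial ℕ R} (hp : lowering t k p = 0) :
    lowering t k (MvPolynomial.X k ^ m * p) =
      (1 - t ^ m) • (MvPolynomial.X k ^ (m - 1) * p) := by
  induction m with
  | zero => simp [hp]
  | succ m ih =>
    rw [pow_succ', mul_assoc, lowering_X_mul, ih, mul_smul_comm, smul_smul, ← mul_assoc, ← pow_succ']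
    rcases m with - | m
    · simp
    · simp only [Nat.add_sub_cancel]
      rw [← add_smul]
      congr 1
      ring

theorem lowering_map {R' : Type*} [CommRing R'] (φ : R →+* R') (t : R) (k : ℕ)
    (p : MvPolynomial ℕ R) :
    lowering (φ t) k (MvPolynomial.map φ p) = MvPolynomial.map φ (lowering t k p) := by
  induction p using MvPolynomial.induction_on' with
  | monomial n c => simp [lowering_monomial]
  | add p q hp hq => simp only [map_add, hp, hq]

/-- The rescaled operators `(u ^ (k - 1) B(u), u ^ k D(u))`, `x = u ^ 2`, for the monodromy
`L_{k - 1}(u) ⋯ L₀(u)` in the polynomial model. -/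
def modelBD (t x : R) : ℕ → Module.End R (MvPolynomial ℕ R) × Module.End R (MvPolynomial ℕ R)
  | 0 => (0, 1)
  | k + 1 =>
    ((modelBD t x k).1 + LinearMap.mulLeft R (MvPolynomial.X k) * (modelBD t x k).2,
      x • (lowering t k * (modelBD t x k).1 + (modelBD t x k).2))

theorem modelBD_succ_fst (t x : R) (k : ℕ) (p : MvPolynomial ℕ R) :
    (modelBD t x (k + 1)).1 p =
      (modelBD t x k).1 p + MvPolynomial.X k * (modelBD t x k).2 p := rfl

theorem modelBD_succ_snd (t x : R) (k : ℕ) (p : MvPolynomial ℕ R) :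
    (modelBD t x (k + 1)).2 p =
      x • (lowering t k ((modelBD t x k).1 p) + (modelBD t x k).2 p) := rfl

/-- Operators built from the sites below `k` do not touch site `j`. -/
theorem modelBD_X_mul (t x : R) {j k : ℕ} (h : k ≤ j) (p : MvPolynomial ℕ R) :
    (modelBD t x k).1 (MvPolynomial.X j * p) = MvPolynomial.X j * (modelBD t x k).1 p ∧
      (modelBD t x k).2 (MvPolynomial.X j * p) = MvPolynomial.X j * (modelBD t x k).2 p := by
  induction k with
  | zero => simp [modelBD]
  | succ k ih =>
    obtain ⟨h1, h2⟩ := ih (by omega)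
    constructor
    · rw [modelBD_succ_fst, modelBD_succ_fst, h1, h2]
      ring
    · rw [modelBD_succ_snd, modelBD_succ_snd, h1, h2, lowering_X_mul_of_ne _ (by omega), ← mul_add,
        mul_smul_comm]

theorem modelBD_X_pow_mul (t x : R) {j k : ℕ} (h : k ≤ j) (m : ℕ) (p : MvPolynomial ℕ R) :
    (modelBD t x k).1 (MvPolynomial.X j ^ m * p) = MvPolynomial.X j ^ m * (modelBD t x k).1 p ∧
      (modelBD t x k).2 (MvPolynomial.X j ^ m * p) =
        MvPolynomial.X j ^ m * (modelBD t x k).2 p := by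
  induction m with
  | zero => simp
  | succ m ih =>
    simp only [pow_succ', mul_assoc, (modelBD_X_mul t x h _).1, (modelBD_X_mul t x h _).2, ih,
      and_self]

/-- Base change, used both to embed indeterminate rapidities in a fraction field and to specialize
them. -/
theorem modelBD_map {R' : Type*} [CommRing R'] (φ : R →+* R') (t x : R) (k : ℕ)
    (p : MvPolynomial ℕ R) :
    (modelBD (φ t) (φ x) k).1 (MvPolynomial.map φ p) = MvPolynomial.map φ ((modelBD t x k).1 p) ∧
      (modelBD (φ t) (φ x) k).2 (MvPolynomial.map φ p) =
        MvPolynomial.map φ ((modelBD t x k).2 p) := by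
  induction k with
  | zero => simp [modelBD]
  | succ k ih =>
    simp only [modelBD_succ_fst, modelBD_succ_snd, ih.1, ih.2, lowering_map, map_add, map_mul,
      MvPolynomial.map_X, MvPolynomial.smul_eq_C_mul, MvPolynomial.map_C, and_self]

/-- `∏ⱼ B(uⱼ) |0⟩`, rescaled, for `k` sites in the polynomial model. -/
def modelPsi (t : R) (k : ℕ) (xs : List R) : MvPolynomial ℕ R :=
  (xs.map fun x => (modelBD t x k).1).prod 1

theorem modelPsi_cons (t : R) (k : ℕ) (x : R) (xs : List R) :
    modelPsi t k (x :: xs) = (modelBD t x k).1 (modelPsi t k xs) := by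
  simp [modelPsi]

theorem modelPsi_map {R' : Type*} [CommRing R'] (φ : R →+* R') (t : R) (k : ℕ) (xs : List R) :
    modelPsi (φ t) k (xs.map φ) = MvPolynomial.map φ (modelPsi t k xs) := by
  induction xs with
  | nil => simp [modelPsi]
  | cons x xs ih => rw [List.map_cons, modelPsi_cons, modelPsi_cons, ih, (modelBD_map φ t x k _).1]

end Model

/-! ### Reindexing sums over subsets -/

section Powerset

variable {ι V : Type*} [DecidableEq ι] [AddCommMonoid V]

theorem erase_sdiff_erase {J T : Finset ι} {i : ι} (hi : i ∈ T) :
    J.erase i \ T.erase i = J \ T := by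
  ext j
  simp only [mem_sdiff, mem_erase]
  constructor
  · rintro ⟨⟨h, h'⟩, h''⟩
    exact ⟨h', fun hj => h'' ⟨h, hj⟩⟩
  · rintro ⟨h, h'⟩
    exact ⟨⟨fun hj => h' (hj ▸ hi), h⟩, fun hj => h' hj.2⟩

/-- A set with a point outside it corresponds to a set with a point inside it, via `T = insert i S`.
-/
theorem sum_powerset_sum_sdiff (J : Finset ι) (h : Finset ι → ι → V) :
    ∑ S ∈ J.powerset, ∑ i ∈ J \ S, h S i = ∑ T ∈ J.powerset, ∑ i ∈ T, h (T.erase i) i := by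
  rw [sum_sigma', sum_sigma']
  refine sum_bij' (fun p _ => ⟨insert p.2 p.1, p.2⟩) (fun p _ => ⟨p.1.erase p.2, p.2⟩) ?_ ?_ ?_ ?_ ?_
  · rintro ⟨S, i⟩ h
    simp only [mem_sigma, mem_powerset, mem_sdiff] at h ⊢
    exact ⟨insert_subset h.2.1 h.1, mem_insert_self _ _⟩
  · rintro ⟨T, i⟩ h
    simp only [mem_sigma, mem_powerset, mem_sdiff] at h ⊢
    exact ⟨(erase_subset _ _).trans h.1, h.1 h.2, notMem_erase _ _⟩
  · rintro ⟨S, i⟩ h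
    simp only [mem_sigma, mem_powerset, mem_sdiff] at h
    simp [erase_insert h.2.2]
  · rintro ⟨T, i⟩ h
    simp only [mem_sigma, mem_powerset] at h
    simp [insert_erase h.2]
  · rintro ⟨S, i⟩ h
    simp only [mem_sigma, mem_powerset, mem_sdiff] at h
    simp [erase_insert h.2.2]

theorem sum_sum_powerset_erase (J : Finset ι) (h : Finset ι → ι → V) :
    ∑ i ∈ J, ∑ S ∈ (J.erase i).powerset, h S i =
      ∑ T ∈ J.powerset, ∑ i ∈ T, h (T.erase i) i := by
  rw [← sum_powerset_sum_sdiff, sum_sigma', sum_sigma']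
  refine sum_bij' (fun p _ => ⟨p.2, p.1⟩) (fun p _ => ⟨p.2, p.1⟩) ?_ ?_ ?_ ?_ ?_
  · rintro ⟨i, S⟩ h
    simp only [mem_sigma, mem_powerset, mem_sdiff, subset_erase] at h ⊢
    tauto
  · rintro ⟨S, i⟩ h
    simp only [mem_sigma, mem_powerset, mem_sdiff, subset_erase] at h ⊢
    tauto
  all_goals simp

end Powerset

/-! ### Identities between the weights -/

section Weights

variable {L ι : Type*} [Field L] [DecidableEq ι] (t : L) (x : ι → L)

/-- `∏_{i ∈ S} xᵢ ^ k ∏_{i ∈ S, j ∈ C} (xᵢ - t xⱼ) / (xᵢ - xⱼ)`. -/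
def weight (k : ℕ) (S C : Finset ι) : L :=
  (∏ i ∈ S, x i ^ k) * ∏ i ∈ S, ∏ j ∈ C, hlFactor t (x i) (x j)

/-- `xᵢ ^ k (f(xᵢ, xₐ) - 1) ∏_{j ∈ C} f(xᵢ, xⱼ)` with `f = hlFactor t`. -/
def exchangeWeight (k : ℕ) (a i : ι) (C : Finset ι) : L :=
  x i ^ k * (hlFactor t (x i) (x a) - 1) * ∏ j ∈ C, hlFactor t (x i) (x j)

variable {t x}

theorem weight_insert_left (k : ℕ) {a : ι} {S : Finset ι} (h : a ∉ S) (C : Finset ι) :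
    weight t x k (insert a S) C =
      x a ^ k * (∏ j ∈ C, hlFactor t (x a) (x j)) * weight t x k S C := by
  simp only [weight, prod_insert h]
  ring

theorem weight_insert_right (k : ℕ) {a : ι} {C : Finset ι} (h : a ∉ C) (S : Finset ι) :
    weight t x k S (insert a C) = (∏ i ∈ S, hlFactor t (x i) (x a)) * weight t x k S C := by
  simp only [weight, prod_insert h, prod_mul_distrib]
  ring

theorem weight_erase (k : ℕ) {i : ι} {T : Finset ι} (h : i ∈ T) (C : Finset ι) :
    weight t x k T C =
      x i ^ k * (∏ j ∈ C, hlFactor t (x i) (x j)) * weight t x k (T.erase i) C := by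
  conv_lhs => rw [← insert_erase h]
  exact weight_insert_left k (notMem_erase _ _) C

theorem weight_erase_mul_exchangeWeight (k : ℕ) (a : ι) {i : ι} {T C : Finset ι} (hi : i ∈ T)
    (hC : i ∉ C) :
    weight t x k (T.erase i) (insert i C) * exchangeWeight t x k a i C =
      weight t x k T C * ((hlFactor t (x i) (x a) - 1) *
        ∏ l ∈ T.erase i, hlFactor t (x l) (x i)) := by
  rw [weight_insert_right k hC, weight_erase k hi, exchangeWeight]
  ring

/-- After division by `weight t x k T C` this is `prod_hlFactor_right`. It collects the terms in
which `D(x_a)` on the lower sites replaces `i` by `a`. -/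
theorem weight_add_sum (hx : Function.Injective x) (hx0 : ∀ i, x i ≠ 0) (k : ℕ) {a : ι}
    {T C : Finset ι} (hT : a ∉ T) (hC : a ∉ C) (hd : Disjoint T C) :
    weight t x k T C + ∑ i ∈ T, weight t x k (T.erase i) (insert i C) * exchangeWeight t x k a i C =
      weight t x k T (insert a C) := by
  rw [sum_congr rfl fun i hi =>
    weight_erase_mul_exchangeWeight k a hi (disjoint_left.mp hd hi), ← mul_sum,
    weight_insert_right k hC, prod_hlFactor_right t x hx hx0 (x a) (hx0 a) T
      fun i hi h => hT (hx h ▸ hi)]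
  ring

/-- A multiple of `prod_hlFactor_sub_pow`; it treats the exchange terms with `a` below site `k`. The
power of `t` will match the one produced by `lowering`. -/
theorem sum_exchangeWeight_mul_weight (hx : Function.Injective x)
    (hxt : ∀ i j, i ≠ j → x i ≠ t * x j) (k : ℕ) {a : ι}
    {T C : Finset ι} (hT : a ∉ T) (hC : a ∉ C) (hd : Disjoint T C) :
    ∑ i ∈ T, exchangeWeight t x (k + 1) a i (T.erase i ∪ C) * weight t x k (T.erase i) (insert a C) =
      x a * (weight t x k T (insert a C) - t ^ T.card * weight t x k T C) := by
  have key := prod_hlFactor_sub_pow t x hx hxt a T hT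
  have : ∀ i ∈ T, exchangeWeight t x (k + 1) a i (T.erase i ∪ C) *
      weight t x k (T.erase i) (insert a C) =
      weight t x k T C * (x i * (hlFactor t (x i) (x a) - 1) *
        (∏ l ∈ T.erase i, hlFactor t (x i) (x l)) * ∏ l ∈ T.erase i, hlFactor t (x l) (x a)) := by
    intro i hi
    rw [weight_insert_right k hC, weight_erase k hi, exchangeWeight,
      prod_union (hd.mono_left (erase_subset _ _))]
    ring
  rw [sum_congr rfl this, ← mul_sum, ← key, weight_insert_right k hC]
  ring

/-- A multiple of `prod_hlFactor_left'`; it treats the diagonal term and the exchange terms with `a`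
at site `k`. -/
theorem sum_exchangeWeight_mul_weight' (hx : Function.Injective x) (k : ℕ) {a : ι}
    {T C : Finset ι} (hT : a ∉ T) (hd : Disjoint T C) :
    x a ^ (k + 1) * (∏ j ∈ T ∪ C, hlFactor t (x a) (x j)) * weight t x k T C +
      ∑ i ∈ T, exchangeWeight t x (k + 1) a i (T.erase i ∪ C) *
        weight t x k (insert a (T.erase i)) C =
      x a * (weight t x k T C * (x a ^ k * ∏ j ∈ C, hlFactor t (x a) (x j))) := by
  have key := prod_hlFactor_left' t x hx a T hT
  have : ∀ i ∈ T, exchangeWeight t x (k + 1) a i (T.erase i ∪ C) *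
      weight t x k (insert a (T.erase i)) C =
      weight t x k T C * (x a ^ k * ∏ j ∈ C, hlFactor t (x a) (x j)) *
        (x i * (hlFactor t (x i) (x a) - 1) * ∏ l ∈ T.erase i, hlFactor t (x i) (x l)) := by
    intro i hi
    rw [weight_insert_left k (fun h => hT (mem_of_mem_erase h)), weight_erase k hi, exchangeWeight,
      prod_union (hd.mono_left (erase_subset _ _))]
    ring
  rw [sum_congr rfl this, ← mul_sum, prod_union hd]
  linear_combination weight t x k T C * (x a ^ k * ∏ j ∈ C, hlFactor t (x a) (x j)) * key

end Weights

/-! ### The explicit wave function and the action of `B` and `D` -/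

section WaveFunction

variable {L ι : Type*} [Field L] [DecidableEq ι] (t : L) (x : ι → L)

/-- The `k`-site state with rapidities `xᵢ`, `i ∈ J`, built up site by site. -/
def bethe : ℕ → Finset ι → MvPolynomial ℕ L
  | 0, J => if J = ∅ then 1 else 0
  | k + 1, J => ∑ S ∈ J.powerset, weight t x k S (J \ S) •
      (MvPolynomial.X k ^ S.card * bethe k (J \ S))

theorem bethe_succ (k : ℕ) (J : Finset ι) :
    bethe t x (k + 1) J = ∑ S ∈ J.powerset, weight t x k S (J \ S) •
      (MvPolynomial.X k ^ S.card * bethe t x k (J \ S)) := rfl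

/-- Either `a` lies below site `k` or it sits at site `k`. -/
theorem bethe_succ_insert (k : ℕ) {a : ι} {J : Finset ι} (ha : a ∉ J) :
    bethe t x (k + 1) (insert a J) =
      ∑ S ∈ J.powerset, (weight t x k S (insert a (J \ S)) •
          (MvPolynomial.X k ^ S.card * bethe t x k (insert a (J \ S))) +
        weight t x k (insert a S) (J \ S) •
          (MvPolynomial.X k ^ (S.card + 1) * bethe t x k (J \ S))) := by
  rw [bethe_succ, sum_powerset_insert ha, ← sum_add_distrib]
  refine sum_congr rfl fun S hS => ?_
  have haS : a ∉ S := fun h => ha (mem_powerset.mp hS h)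
  rw [insert_sdiff_of_notMem _ haS, insert_sdiff_insert, sdiff_insert_of_notMem ha,
    card_insert_of_notMem haS]

/-- Only variables of sites below `k` occur, so site `j` is in its vacuum. -/
theorem lowering_bethe {j k : ℕ} (h : k ≤ j) (J : Finset ι) :
    lowering t j (bethe t x k J) = 0 := by
  induction k generalizing J with
  | zero =>
    rw [bethe]
    split_ifs
    · rw [MvPolynomial.one_def, lowering_monomial]
      simp
    · simp
  | succ k ih =>
    rw [bethe_succ, map_sum]
    refine sum_eq_zero fun S _ => ?_
    rw [map_smul]
    have : ∀ m p, lowering t j p = 0 → lowering t j (MvPolynomial.X k ^ m * p) = 0 := by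
      intro m p hp
      induction m with
      | zero => simpa using hp
      | succ m ihm => rw [pow_succ', mul_assoc, lowering_X_mul_of_ne _ (by omega), ihm, mul_zero]
    rw [this _ _ (ih (by omega) _), smul_zero]

variable {t x}

/-- Both actions are proved together, since each step of the recursion mixes `B` and `D`. All sums
are indexed by the subset `T` that fixes the lower rapidities `J \ T`, and are compared term by term
in `T`. -/
theorem modelBD_bethe (hx : Function.Injective x) (hx0 : ∀ i, x i ≠ 0)
    (hxt : ∀ i j, i ≠ j → x i ≠ t * x j) (k : ℕ) :
    ∀ (J : Finset ι) (a : ι), a ∉ J →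
      (modelBD t (x a) k).1 (bethe t x k J) = bethe t x k (insert a J) ∧
      (modelBD t (x a) k).2 (bethe t x k J) =
        (x a ^ k * ∏ j ∈ J, hlFactor t (x a) (x j)) • bethe t x k J +
          ∑ i ∈ J, exchangeWeight t x k a i (J.erase i) • bethe t x k (insert a (J.erase i)) := by
  induction k with
  | zero =>
    intro J a ha
    have hne : ∀ C : Finset ι, bethe t x 0 (insert a C) = 0 := fun C =>
      if_neg (insert_ne_empty a C)
    constructor
    · rw [hne]
      rfl
    · simp only [hne, smul_zero, sum_const_zero, add_zero]
      change bethe t x 0 J = _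
      by_cases hJ : J = ∅
      · simp [hJ]
      · simp [bethe, hJ]
  | succ k ih =>
    intro J a ha
    have hsub : ∀ {T}, T ∈ J.powerset → a ∉ T ∧ a ∉ J \ T ∧ Disjoint T (J \ T) := fun hT =>
      ⟨fun h => ha (mem_powerset.mp hT h), fun h => ha (mem_sdiff.mp h).1, disjoint_sdiff⟩
    have hB0 : (modelBD t (x a) k).1 (bethe t x (k + 1) J) =
        ∑ T ∈ J.powerset, weight t x k T (J \ T) •
          (MvPolynomial.X k ^ T.card * bethe t x k (insert a (J \ T))) := by
      rw [bethe_succ, map_sum]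
      refine sum_congr rfl fun T hT => ?_
      rw [map_smul, (modelBD_X_pow_mul t (x a) le_rfl _ _).1, (ih _ _ (hsub hT).2.1).1]
    -- An exchange moves some `i` out of the lower sites while `S` stays at site `k`. Regrouping by
    -- `T = insert i S` explains the exponent `T.card - 1`, and `weight_add_sum` evaluates the
    -- coefficient.
    have hD0 : (modelBD t (x a) k).2 (bethe t x (k + 1) J) =
        ∑ T ∈ J.powerset, ((weight t x k T (J \ T) *
            (x a ^ k * ∏ j ∈ J \ T, hlFactor t (x a) (x j))) •
              (MvPolynomial.X k ^ T.card * bethe t x k (J \ T)) +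
          (weight t x k T (insert a (J \ T)) - weight t x k T (J \ T)) •
              (MvPolynomial.X k ^ (T.card - 1) * bethe t x k (insert a (J \ T)))) := by
      have hS : ∀ S ∈ J.powerset, (modelBD t (x a) k).2
          (weight t x k S (J \ S) • (MvPolynomial.X k ^ S.card * bethe t x k (J \ S))) =
          (weight t x k S (J \ S) * (x a ^ k * ∏ j ∈ J \ S, hlFactor t (x a) (x j))) •
              (MvPolynomial.X k ^ S.card * bethe t x k (J \ S)) +
            ∑ i ∈ J \ S, (weight t x k S (J \ S) * exchangeWeight t x k a i ((J \ S).erase i)) •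
              (MvPolynomial.X k ^ S.card * bethe t x k (insert a ((J \ S).erase i))) := by
        intro S hS
        rw [map_smul, (modelBD_X_pow_mul t (x a) le_rfl _ _).2, (ih _ _ (hsub hS).2.1).2, mul_add,
          smul_add, mul_smul_comm, smul_smul, mul_sum, smul_sum]
        congr 1
        refine sum_congr rfl fun i _ => ?_
        rw [mul_smul_comm, smul_smul]
      rw [bethe_succ, map_sum, sum_congr rfl hS, sum_add_distrib, sum_add_distrib,
        sum_powerset_sum_sdiff J fun S i =>
          (weight t x k S (J \ S) * exchangeWeight t x k a i ((J \ S).erase i)) •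
              (MvPolynomial.X k ^ S.card * bethe t x k (insert a ((J \ S).erase i)))]
      congr 1
      refine sum_congr rfl fun T hT => ?_
      obtain ⟨h1, h2, h3⟩ := hsub hT
      rw [← weight_add_sum hx hx0 k h1 h2 h3, add_sub_cancel_left, sum_smul]
      refine sum_congr rfl fun i hi => ?_
      have hi' : i ∉ J \ T := disjoint_left.mp h3 hi
      rw [sdiff_erase (mem_powerset.mp hT hi), erase_insert hi', card_erase_of_mem hi]
    have hB : (modelBD t (x a) (k + 1)).1 (bethe t x (k + 1) J) =
        bethe t x (k + 1) (insert a J) := by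
      rw [bethe_succ_insert _ _ _ ha, modelBD_succ_fst, hB0, hD0, mul_sum, ← sum_add_distrib]
      refine sum_congr rfl fun T hT => ?_
      -- For empty `T` the exponent `T.card - 1` is truncated, but then the difference of weights is
      -- zero.
      have hp : (weight t x k T (insert a (J \ T)) - weight t x k T (J \ T)) •
          (MvPolynomial.X k * (MvPolynomial.X k ^ (T.card - 1) *
            bethe t x k (insert a (J \ T)))) =
          (weight t x k T (insert a (J \ T)) - weight t x k T (J \ T)) •
          (MvPolynomial.X k ^ T.card * bethe t x k (insert a (J \ T))) := by
        rcases T.eq_empty_or_nonempty with rfl | hne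
        · simp [weight]
        · rw [← mul_assoc, ← pow_succ', Nat.sub_add_cancel (card_pos.mpr hne)]
      rw [mul_add, mul_smul_comm, mul_smul_comm, hp, weight_insert_left k (hsub hT).1,
        sub_smul, pow_succ', mul_assoc (MvPolynomial.X k), mul_comm (weight t x k T (J \ T))]
      abel
    refine ⟨hB, ?_⟩
    have hexp : ∀ i ∈ J, exchangeWeight t x (k + 1) a i (J.erase i) •
        bethe t x (k + 1) (insert a (J.erase i)) =
        ∑ S ∈ (J.erase i).powerset, ((exchangeWeight t x (k + 1) a i (J.erase i) *
            weight t x k S (insert a (J.erase i \ S))) •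
            (MvPolynomial.X k ^ S.card * bethe t x k (insert a (J.erase i \ S))) +
          (exchangeWeight t x (k + 1) a i (J.erase i) *
            weight t x k (insert a S) (J.erase i \ S)) •
            (MvPolynomial.X k ^ (S.card + 1) * bethe t x k (J.erase i \ S))) := by
      intro i _
      rw [bethe_succ_insert _ _ _ fun h => ha (mem_of_mem_erase h), smul_sum]
      refine sum_congr rfl fun S _ => ?_
      rw [smul_add, smul_smul, smul_smul]
    rw [modelBD_succ_snd, hB0, hD0, map_sum, ← sum_add_distrib, sum_congr rfl hexp,
      sum_sum_powerset_erase J fun S i => (exchangeWeight t x (k + 1) a i (J.erase i) *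
            weight t x k S (insert a (J.erase i \ S))) •
            (MvPolynomial.X k ^ S.card * bethe t x k (insert a (J.erase i \ S))) +
          (exchangeWeight t x (k + 1) a i (J.erase i) *
            weight t x k (insert a S) (J.erase i \ S)) •
            (MvPolynomial.X k ^ (S.card + 1) * bethe t x k (J.erase i \ S)),
      bethe_succ, smul_sum, smul_sum, ← sum_add_distrib]
    refine sum_congr rfl fun T hT => ?_
    obtain ⟨h1, h2, h3⟩ := hsub hT
    have hTJ := mem_powerset.mp hT
    have hterm : ∀ i ∈ T, (exchangeWeight t x (k + 1) a i (J.erase i) *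
            weight t x k (T.erase i) (insert a (J.erase i \ T.erase i))) •
            (MvPolynomial.X k ^ (T.erase i).card *
              bethe t x k (insert a (J.erase i \ T.erase i))) +
          (exchangeWeight t x (k + 1) a i (J.erase i) *
            weight t x k (insert a (T.erase i)) (J.erase i \ T.erase i)) •
            (MvPolynomial.X k ^ ((T.erase i).card + 1) * bethe t x k (J.erase i \ T.erase i)) =
        (exchangeWeight t x (k + 1) a i (T.erase i ∪ J \ T) *
            weight t x k (T.erase i) (insert a (J \ T))) •
            (MvPolynomial.X k ^ (T.card - 1) * bethe t x k (insert a (J \ T))) +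
          (exchangeWeight t x (k + 1) a i (T.erase i ∪ J \ T) *
            weight t x k (insert a (T.erase i)) (J \ T)) •
            (MvPolynomial.X k ^ T.card * bethe t x k (J \ T)) := by
      intro i hi
      have e1 : J.erase i \ T.erase i = J \ T := erase_sdiff_erase hi
      have e2 : J.erase i = T.erase i ∪ J \ T := by
        rw [← e1, union_sdiff_of_subset (erase_subset_erase i hTJ)]
      have e3 : (T.erase i).card + 1 = T.card := card_erase_add_one hi
      rw [e1, ← e2, e3, card_erase_of_mem hi]
    -- Site `k` is empty in the lower state, so `lowering` contributes the factor `1 - t ^ T.card`;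
    -- two coefficients remain to be matched.
    rw [sum_congr rfl hterm, sum_add_distrib, ← sum_smul, ← sum_smul,
      sum_exchangeWeight_mul_weight hx hxt k h1 h2 h3, map_smul,
      lowering_X_pow_mul t k _ (lowering_bethe t x le_rfl _)]
    have key := sum_exchangeWeight_mul_weight' (t := t) hx k h1 h3
    rw [union_sdiff_of_subset hTJ] at key
    rw [smul_add, smul_add, smul_smul, smul_smul, smul_smul, smul_smul, smul_smul, ← key, add_smul]
    generalize MvPolynomial.X k ^ (T.card - 1) * bethe t x k (insert a (J \ T)) = p
    generalize MvPolynomial.X k ^ T.card * bethe t x k (J \ T) = q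
    module

/-- Each further operator inserts its rapidity into the set; the vacuum corresponds to the empty set
for every number of sites. -/
theorem modelPsi_eq_bethe (hx : Function.Injective x) (hx0 : ∀ i, x i ≠ 0)
    (hxt : ∀ i j, i ≠ j → x i ≠ t * x j) (k : ℕ) {js : List ι} (hjs : js.Nodup) :
    modelPsi t k (js.map x) = bethe t x k js.toFinset := by
  induction js with
  | nil =>
    change 1 = bethe t x k ∅
    induction k with
    | zero => simp [bethe]
    | succ k ih => rw [bethe_succ]; simp [← ih, weight]
  | cons a js ih =>
    obtain ⟨h1, h2⟩ := List.nodup_cons.mp hjs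
    rw [List.map_cons, modelPsi_cons, ih h2, List.toFinset_cons]
    exact (modelBD_bethe hx hx0 hxt k _ _ (by simpa using h1)).1

end WaveFunction

/-! ### Coefficients of the wave function as symmetrized sums -/

section Symmetrization

variable {L ι : Type*} [Field L] [DecidableEq ι] (t : L) (x : ι → L)

/-- The symmetrization of `∏ xᵢ ^ lᵢ ∏_{i < j} (xᵢ - t xⱼ) / (xᵢ - xⱼ)` over the variables in `J`,
built up one variable at a time. -/
def symmetrized : Finset ι → List ℕ → L
  | _, [] => 1
  | J, a :: l => ∑ k ∈ J, x k ^ a * (∏ j ∈ J.erase k, hlFactor t (x k) (x j)) *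
      symmetrized (J.erase k) l

theorem symmetrized_cons (J : Finset ι) (a : ℕ) (l : List ℕ) :
    symmetrized t x J (a :: l) = ∑ k ∈ J, x k ^ a * (∏ j ∈ J.erase k, hlFactor t (x k) (x j)) *
      symmetrized t x (J.erase k) l := rfl

variable {t x}

theorem vFactor_succ (m : ℕ) : vFactor t (m + 1) = vFactor t m * qInt t (m + 1) := by
  rw [vFactor, prod_Icc_succ_top (by omega)]
  rfl

/-- Let `S` be the set of variables receiving the exponent `a`. Factors between `S` and its
complement do not depend on the order inside `S`. Summing over the first variable chosen gives a
`q`-integer by `sum_prod_hlFactor`, and these multiply up to `vFactor t m`. -/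
theorem symmetrized_replicate_append (ht : t ≠ 1) (hx : Function.Injective x)
    (hx0 : ∀ i, x i ≠ 0) (m a : ℕ) (l : List ℕ) (J : Finset ι) :
    symmetrized t x J (List.replicate m a ++ l) = ∑ S ∈ J.powerset,
      if S.card = m then weight t x a S (J \ S) * vFactor t m * symmetrized t x (J \ S) l else 0 := by
  induction m generalizing J with
  | zero =>
    rw [sum_eq_single ∅]
    · simp [weight, vFactor]
    · intro S _ h
      rw [if_neg (by simpa using h)]
    · simp
  | succ m ih =>
    rw [List.replicate_succ, List.cons_append, symmetrized_cons]
    simp only [ih, mul_sum]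
    rw [sum_sum_powerset_erase J fun S k =>
      x k ^ a * (∏ j ∈ J.erase k, hlFactor t (x k) (x j)) * if S.card = m then
        weight t x a S (J.erase k \ S) * vFactor t m * symmetrized t x (J.erase k \ S) l else 0]
    refine sum_congr rfl fun T hT => ?_
    have hTJ := mem_powerset.mp hT
    split_ifs with hc
    · rw [vFactor_succ, ← hc, ← sum_prod_hlFactor t ht x hx hx0 T, mul_sum, mul_sum, sum_mul]
      refine sum_congr rfl fun k hk => ?_
      have e2 : J.erase k = T.erase k ∪ J \ T := by
        rw [← erase_sdiff_erase hk, union_sdiff_of_subset (erase_subset_erase k hTJ)]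
      rw [if_pos (by rw [card_erase_of_mem hk]; omega), erase_sdiff_erase hk, e2,
        prod_union (disjoint_sdiff.mono_left (erase_subset _ _)), weight_erase a hk]
      ring
    · refine sum_eq_zero fun k hk => ?_
      have := card_erase_add_one hk
      rw [if_neg (by omega), mul_zero]

/-- The weakly decreasing sequence that consists of `n i` entries `i` for each `i < k`. -/
def partsList (n : ℕ → ℕ) : ℕ → List ℕ
  | 0 => []
  | k + 1 => List.replicate (n k) k ++ partsList n k

theorem partsList_congr {n n' : ℕ → ℕ} {k : ℕ} (h : ∀ i < k, n i = n' i) :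
    partsList n k = partsList n' k := by
  induction k with
  | zero => rfl
  | succ k ih => rw [partsList, partsList, h k (by omega), ih fun i hi => h i (by omega)]

/-- Particle number conservation: each rapidity is placed at exactly one of the `k` sites. -/
theorem coeff_bethe_ne_zero (k : ℕ) (J : Finset ι) (n : ℕ →₀ ℕ)
    (h : MvPolynomial.coeff n (bethe t x k J) ≠ 0) :
    (∀ i, k ≤ i → n i = 0) ∧ ∑ i ∈ range k, n i = J.card := by
  induction k generalizing J n with
  | zero =>
    rw [bethe] at h
    split_ifs at h with hJ
    · rw [MvPolynomial.coeff_one] at h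
      have : 0 = n := by
        by_contra h'
        exact h (if_neg h')
      simp [← this, hJ]
    · simp at h
  | succ k ih =>
    rw [bethe_succ, MvPolynomial.coeff_sum] at h
    obtain ⟨S, hS, hne⟩ := exists_ne_zero_of_sum_ne_zero h
    rw [MvPolynomial.coeff_smul, MvPolynomial.X_pow_eq_monomial,
      MvPolynomial.coeff_monomial_mul'] at hne
    split_ifs at hne with hle
    · rw [one_mul] at hne
      obtain ⟨h1, h2⟩ := ih _ _ (right_ne_zero_of_mul hne)
      have hle' := Finsupp.single_le_iff.mp hle
      have hv : ∀ i, (n - Finsupp.single k S.card) i = if i = k then n k - S.card else n i := by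
        intro i
        rw [Finsupp.tsub_apply, Finsupp.single_apply]
        split_ifs with h1 h2 h2
        · rw [h1]
        · exact absurd h1.symm h2
        · exact absurd h2.symm h1
        · simp
      have hk := h1 k le_rfl
      rw [hv, if_pos rfl] at hk
      refine ⟨fun i hi => ?_, ?_⟩
      · have := h1 i (by omega)
        rwa [hv, if_neg (by omega)] at this
      · have e : ∑ i ∈ range k, (n - Finsupp.single k S.card) i = ∑ i ∈ range k, n i :=
          sum_congr rfl fun i hi => by rw [hv, if_neg (mem_range.mp hi).ne]
        rw [e] at h2
        have := card_sdiff_add_card_eq_card (mem_powerset.mp hS)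
        rw [sum_range_succ]
        omega
    · simp at hne

/-- Both sides satisfy the same recursion over subsets `S` of size `n k`, and the summands agree one
by one. -/
theorem coeff_bethe_mul (ht : t ≠ 1) (hx : Function.Injective x)
    (hx0 : ∀ i, x i ≠ 0) (k : ℕ) (J : Finset ι) (n : ℕ →₀ ℕ)
    (h1 : ∀ i, k ≤ i → n i = 0) (h2 : ∑ i ∈ range k, n i = J.card) :
    MvPolynomial.coeff n (bethe t x k J) * ∏ i ∈ range k, vFactor t (n i) =
      symmetrized t x J (partsList n k) := by
  induction k generalizing J n with
  | zero =>
    have hJ : J = ∅ := by simpa [eq_comm] using h2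
    have hn : n = 0 := by
      ext i
      exact h1 i (Nat.zero_le _)
    simp [bethe, hJ, hn, partsList, symmetrized]
  | succ k ih =>
    rw [partsList, symmetrized_replicate_append ht hx hx0, bethe_succ, MvPolynomial.coeff_sum,
      sum_mul]
    refine sum_congr rfl fun S hS => ?_
    have hcard := card_sdiff_add_card_eq_card (mem_powerset.mp hS)
    rw [sum_range_succ] at h2
    simp only [MvPolynomial.coeff_smul, MvPolynomial.X_pow_eq_monomial,
      MvPolynomial.coeff_monomial_mul', smul_eq_mul, one_mul, Finsupp.single_le_iff]
    split_ifs with hle hc hc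
    · have hv : ∀ i, i ≠ k → (n - Finsupp.single k S.card) i = n i := by
        intro i hi
        simp [hi.symm]
      have hv' : ∀ i ∈ range k, (n - Finsupp.single k S.card) i = n i := fun i hi =>
        hv i (mem_range.mp hi).ne
      have := ih (J \ S) (n - Finsupp.single k S.card) (fun i hi => by
          rcases eq_or_ne i k with rfl | hik
          · simp [hc]
          · rw [hv i hik]
            exact h1 i (by omega)) (by
          have : ∑ i ∈ range k, (n - Finsupp.single k S.card) i = ∑ i ∈ range k, n i :=
            sum_congr rfl hv'
          omega)
      rw [prod_congr rfl fun i hi => by rw [hv' i hi],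
        partsList_congr fun i hi => hv' i (mem_range.mpr hi)] at this
      rw [prod_range_succ, ← this]
      ring
    -- If `S` is smaller than `n k`, a power of `X_k` is left over, which the lower state cannot
    -- supply.
    · rw [(not_imp_comm.mp (coeff_bethe_ne_zero k (J \ S) (n - Finsupp.single k S.card))) fun h => hc ?_]
      · simp
      · have := h.1 k le_rfl
        simp at this
        omega
    · omega
    · simp

theorem symmetrized_ofFn [Fintype ι] {n : ℕ} (l : Fin n → ℕ) (J : Finset ι) (hJ : J.card = n) :
    symmetrized t x J (List.ofFn l) = ∑ w : Fin n → ι,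
      if Function.Injective w ∧ ∀ i, w i ∈ J then
        (∏ i, x (w i) ^ l i) * ∏ i, ∏ j ∈ Ioi i, hlFactor t (x (w i)) (x (w j)) else 0 := by
  classical
  induction n generalizing J with
  | zero => simp [symmetrized, Function.injective_of_subsingleton]
  | succ n ih =>
    rw [List.ofFn_succ, symmetrized_cons,
      ← Fintype.sum_equiv (Fin.consEquiv fun _ : Fin (n + 1) => ι) _ _ fun _ => rfl,
      Fintype.sum_prod_type, ← sum_subset (subset_univ J)]
    · refine sum_congr rfl fun k hk => ?_
      rw [ih (fun i => l i.succ) (J.erase k) (by rw [card_erase_of_mem hk, hJ]; rfl), mul_sum]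
      refine sum_congr rfl fun w _ => ?_
      have hiff : (Function.Injective (Fin.cons k w : Fin (n + 1) → ι) ∧
          ∀ i, (Fin.cons k w : Fin (n + 1) → ι) i ∈ J) ↔
          (Function.Injective w ∧ ∀ i, w i ∈ J.erase k) := by
        simp only [Fin.cons_injective_iff, Fin.forall_fin_succ, Fin.cons_zero, Fin.cons_succ,
          mem_erase, Set.mem_range, not_exists]
        constructor
        · rintro ⟨⟨a, b⟩, c, d⟩
          exact ⟨b, fun i => ⟨a i, d i⟩⟩
        · rintro ⟨b, e⟩
          exact ⟨⟨fun i => (e i).1, b⟩, hk, fun i => (e i).2⟩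
      have hcons : (Fin.consEquiv fun _ : Fin (n + 1) => ι) (k, w) = (Fin.cons k w : Fin (n + 1) → ι) :=
        rfl
      simp only [hcons, hiff]
      split_ifs with h
      -- Since `J` has exactly as many elements as there are positions, the variables other than `k`
      -- are those at later positions.
      · have himg : univ.image w = J.erase k := by
          refine eq_of_subset_of_card_le (fun i hi => ?_) ?_
          · obtain ⟨j, -, rfl⟩ := mem_image.mp hi
            exact h.2 j
          · rw [card_image_of_injective _ h.1, card_erase_of_mem hk, hJ]
            simp
        have hIoi : ∀ (g : Fin (n + 1) → L) (i : Fin n),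
            ∏ j ∈ Ioi i.succ, g j = ∏ j ∈ Ioi i, g j.succ := fun g i => by
          rw [← Fin.map_succEmb_Ioi, prod_map]
          rfl
        rw [Fin.prod_univ_succ, Fin.prod_univ_succ, ← himg, prod_image fun a _ b _ hab => h.1 hab]
        simp only [Fin.cons_zero, Fin.cons_succ, hIoi, Fin.prod_Ioi_zero]
        ring
      · simp
    · intro k _ hk
      refine sum_eq_zero fun w _ => if_neg fun h => hk ?_
      simpa using h.2 0

theorem symmetrized_univ {N : ℕ} (x : Fin N → L) (l : Fin N → ℕ) :
    symmetrized t x univ (List.ofFn l) = ∑ w : Equiv.Perm (Fin N),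
      (∏ i, x (w i) ^ l i) * ∏ p ∈ ltPairs N, hlFactor t (x (w p.1)) (x (w p.2)) := by
  classical
  have hp : ∀ w : Fin N → Fin N, ∏ i, ∏ j ∈ Ioi i, hlFactor t (x (w i)) (x (w j)) =
      ∏ p ∈ ltPairs N, hlFactor t (x (w p.1)) (x (w p.2)) := by
    intro w
    rw [prod_sigma', ltPairs]
    refine prod_bij' (fun p _ => (p.1, p.2)) (fun p _ => ⟨p.1, p.2⟩) ?_ ?_ ?_ ?_ ?_ <;> simp
  rw [symmetrized_ofFn l univ (by simp), ← sum_filter]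
  refine (sum_bij (M := L) (fun (w : Equiv.Perm (Fin N)) _ => (w : Fin N → Fin N)) ?_ ?_ ?_ ?_).symm
  · intro w _
    simpa using w.injective
  · intro w _ w' _ h
    exact DFunLike.coe_injective h
  · intro w hw
    have hw' : Function.Injective w := by simpa using hw
    exact ⟨Equiv.ofBijective w (Finite.injective_iff_bijective.mp hw'), mem_univ _, rfl⟩
  · intro w _
    rw [hp]

end Symmetrization

/-! ### Young diagrams and occupation numbers -/

section Diagrams

theorem mem_box {N M : ℕ} {l : YoungDiagram} : l ∈ box N M ↔ l.colLen 0 ≤ N ∧ l.rowLen 0 ≤ M := by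
  simp [box]

theorem mult_eq_count_range (N : ℕ) (l : YoungDiagram) (i : ℕ) :
    mult N l i = ((List.range N).map l.rowLen).count i := by
  induction N with
  | zero => simp [mult]
  | succ N ih =>
    rw [mult, range_add_one, filter_insert, List.range_succ, List.map_append, List.count_append, ← ih]
    split_ifs with h
    · rw [card_insert_of_notMem (by simp)]
      simp [h, mult]
    · simp [h, mult]

theorem rowLen_eq_zero {l : YoungDiagram} {r : ℕ} (h : l.colLen 0 ≤ r) : l.rowLen r = 0 := by
  by_contra h0
  have : (r, 0) ∈ l := YoungDiagram.mem_iff_lt_rowLen.mpr (Nat.pos_of_ne_zero h0)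
  have := YoungDiagram.mem_iff_lt_colLen.mp this
  omega

theorem map_rowLen_range {N : ℕ} {l : YoungDiagram} (h : l.colLen 0 ≤ N) :
    (List.range N).map l.rowLen = l.rowLens ++ List.replicate (N - l.colLen 0) 0 := by
  obtain ⟨d, rfl⟩ := Nat.exists_eq_add_of_le h
  rw [List.range_add, List.map_append, Nat.add_sub_cancel_left]
  congr 1
  rw [List.map_map, List.eq_replicate_iff]
  refine ⟨by simp, fun b hb => ?_⟩
  obtain ⟨j, -, rfl⟩ := List.mem_map.mp hb
  exact rowLen_eq_zero (Nat.le_add_right _ _)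

theorem mult_eq_count {N : ℕ} {l : YoungDiagram} (h : l.colLen 0 ≤ N) (i : ℕ) :
    mult N l i = l.rowLens.count i + if i = 0 then N - l.colLen 0 else 0 := by
  rw [mult_eq_count_range, map_rowLen_range h, List.count_append, List.count_replicate]
  rcases eq_or_ne i 0 with rfl | hi
  · simp
  · simp [hi, hi.symm]

theorem mult_eq_zero {N M : ℕ} {l : YoungDiagram} (h : l.rowLen 0 ≤ M) {i : ℕ} (hi : M < i) :
    mult N l i = 0 := by
  rw [mult, card_eq_zero, filter_eq_empty_iff]
  intro r _ hr
  have := l.rowLen_anti 0 r (Nat.zero_le _)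
  omega

theorem sum_mult {N M : ℕ} {l : YoungDiagram} (h : l.rowLen 0 ≤ M) :
    ∑ i ∈ range (M + 1), mult N l i = N := by
  have := card_eq_sum_card_fiberwise (f := l.rowLen) (s := range N) (t := range (M + 1))
    fun r _ => by
      have := l.rowLen_anti 0 r (Nat.zero_le _)
      simp only [coe_range, Set.mem_Iio]
      omega
  rw [card_range] at this
  exact this.symm

theorem count_partsList (n : ℕ → ℕ) (k a : ℕ) :
    (partsList n k).count a = if a < k then n a else 0 := by
  induction k with
  | zero => simp [partsList]
  | succ k ih =>
    rw [partsList, List.count_append, ih, List.count_replicate]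
    rcases lt_trichotomy a k with h | rfl | h
    · simp [h, h.ne', Nat.lt_succ_of_lt h]
    · simp
    · rw [if_neg (by simpa using h.ne), if_neg (by omega), if_neg (by omega)]

theorem mem_partsList {n : ℕ → ℕ} {k a : ℕ} (h : a ∈ partsList n k) : a < k := by
  by_contra hk
  have := List.count_pos_iff.mpr h
  rw [count_partsList, if_neg hk] at this
  omega

theorem partsList_sortedGE (n : ℕ → ℕ) (k : ℕ) : (partsList n k).SortedGE := by
  refine List.Pairwise.sortedGE ?_
  induction k with
  | zero => simp [partsList]
  | succ k ih =>
    rw [partsList, List.pairwise_append]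
    refine ⟨List.pairwise_replicate.mpr (Or.inr le_rfl), ih, fun a ha b hb => ?_⟩
    rw [List.eq_of_mem_replicate ha]
    exact (mem_partsList hb).le

/-- Both lists are weakly decreasing and have the same multiplicities. -/
theorem ofFn_rowLen {N M : ℕ} {l : YoungDiagram} (h : l.rowLen 0 ≤ M) :
    List.ofFn (fun i : Fin N => l.rowLen i) = partsList (mult N l) (M + 1) := by
  have he : List.ofFn (fun i : Fin N => l.rowLen i) = (List.range N).map l.rowLen := by
    rw [List.ofFn_eq_map, ← List.map_coe_finRange_eq_range, List.map_map]
    rfl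
  refine List.Perm.eq_of_sortedGE ?_ (partsList_sortedGE _ _) ?_
  · refine List.Pairwise.sortedGE ?_
    rw [List.pairwise_ofFn]
    intro i j hij
    exact l.rowLen_anti _ _ (le_of_lt hij)
  · rw [List.perm_iff_count]
    intro a
    rw [he, ← mult_eq_count_range, count_partsList]
    split_ifs with ha
    · rfl
    · exact mult_eq_zero h (by omega)

/-- The parts of `diagramOf n` as a multiset. -/
def positiveParts {M : ℕ} (n : Fin (M + 1) → ℕ) : Multiset ℕ :=
  ∑ i : Fin M, Multiset.replicate (n i.succ) ((i : ℕ) + 1)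

theorem count_positiveParts {M : ℕ} (n : Fin (M + 1) → ℕ) (a : ℕ) :
    (positiveParts n).count a = ∑ i : Fin M, if (i : ℕ) + 1 = a then n i.succ else 0 := by
  rw [positiveParts, Multiset.count_sum']
  simp only [Multiset.count_replicate]

theorem count_positiveParts_succ {M : ℕ} (n : Fin (M + 1) → ℕ) (i : Fin M) :
    (positiveParts n).count ((i : ℕ) + 1) = n i.succ := by
  rw [count_positiveParts, Finset.sum_eq_single i]
  · simp
  · intro j _ hj
    rw [if_neg fun h => hj (Fin.ext (by omega))]
  · simp

theorem mem_positiveParts {M : ℕ} {n : Fin (M + 1) → ℕ} {a : ℕ} (h : a ∈ positiveParts n) :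
    0 < a ∧ a ≤ M := by
  obtain ⟨i, -, hi⟩ := Multiset.mem_sum.mp h
  rw [Multiset.eq_of_mem_replicate hi]
  omega

theorem card_positiveParts {M : ℕ} (n : Fin (M + 1) → ℕ) :
    (positiveParts n).card = ∑ i : Fin M, n i.succ := by
  simp [positiveParts]

theorem rowLens_diagramOf {M : ℕ} (n : Fin (M + 1) → ℕ) :
    (diagramOf n).rowLens = (positiveParts n).sort (· ≥ ·) :=
  YoungDiagram.rowLens_ofRowLens_eq_self fun _ ha =>
    (mem_positiveParts ((Multiset.mem_sort _).mp ha)).1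

theorem colLen_diagramOf {M : ℕ} (n : Fin (M + 1) → ℕ) :
    (diagramOf n).colLen 0 = ∑ i : Fin M, n i.succ := by
  rw [← YoungDiagram.length_rowLens, rowLens_diagramOf, Multiset.length_sort, card_positiveParts]

theorem rowLen_diagramOf_le {M : ℕ} (n : Fin (M + 1) → ℕ) : (diagramOf n).rowLen 0 ≤ M := by
  rcases Nat.eq_zero_or_pos ((diagramOf n).colLen 0) with h | h
  · rw [rowLen_eq_zero h.le]
    exact Nat.zero_le _
  · have : (diagramOf n).rowLen 0 ∈ (diagramOf n).rowLens :=
      List.mem_map.mpr ⟨0, List.mem_range.mpr h, rfl⟩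
    rw [rowLens_diagramOf, Multiset.mem_sort] at this
    exact (mem_positiveParts this).2

theorem diagramOf_mem_box {N M : ℕ} {n : Fin (M + 1) → ℕ} (h : ∑ i, n i = N) :
    diagramOf n ∈ box N M := by
  rw [Fin.sum_univ_succ] at h
  rw [mem_box, colLen_diagramOf]
  exact ⟨by omega, rowLen_diagramOf_le n⟩

/-- The diagram forgets `n 0`, but the total `N` recovers it. -/
theorem occupation_diagramOf {N M : ℕ} {n : Fin (M + 1) → ℕ} (h : ∑ i, n i = N) :
    occupation N M (diagramOf n) = n := by
  funext i
  rw [occupation, mult_eq_count (mem_box.mp (diagramOf_mem_box h)).1, rowLens_diagramOf,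
    colLen_diagramOf, ← Multiset.coe_count, Multiset.sort_eq]
  rw [Fin.sum_univ_succ] at h
  refine Fin.cases ?_ (fun i => ?_) i
  · have : (positiveParts n).count 0 = 0 :=
      Multiset.count_eq_zero.mpr fun h => (mem_positiveParts h).1.ne rfl
    simp only [Fin.val_zero, if_true, this]
    omega
  · rw [Fin.val_succ, count_positiveParts_succ, if_neg (by omega), add_zero]

theorem diagramOf_occupation {N M : ℕ} {l : YoungDiagram} (h : l ∈ box N M) :
    diagramOf (occupation N M l) = l := by
  obtain ⟨h1, h2⟩ := mem_box.mp h
  refine YoungDiagram.equivListRowLens.injective (Subtype.ext ?_)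
  change (diagramOf (occupation N M l)).rowLens = l.rowLens
  refine List.Perm.eq_of_sortedGE (YoungDiagram.rowLens_sorted _) (YoungDiagram.rowLens_sorted _) ?_
  rw [List.perm_iff_count]
  intro a
  rw [rowLens_diagramOf, ← Multiset.coe_count, Multiset.sort_eq]
  have hm : ∀ b, b ∈ l.rowLens → 0 < b ∧ b ≤ M := fun b hb => by
    refine ⟨l.pos_of_mem_rowLens b hb, ?_⟩
    obtain ⟨r, -, rfl⟩ := List.mem_map.mp hb
    exact (l.rowLen_anti 0 r (Nat.zero_le _)).trans h2
  by_cases ha : 0 < a ∧ a ≤ M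
  · obtain ⟨i, rfl⟩ : ∃ i : Fin M, (i : ℕ) + 1 = a := ⟨⟨a - 1, by omega⟩, by simp; omega⟩
    rw [count_positiveParts_succ, occupation, Fin.val_succ, mult_eq_count h1, if_neg (by omega),
      add_zero]
  · rw [Multiset.count_eq_zero.mpr fun h => ha (mem_positiveParts h),
      List.count_eq_zero.mpr fun h => ha (hm a h)]

/-- Indices beyond the longest row have multiplicity zero and contribute an empty product. -/
theorem vDiagram_eq {K : Type*} [Field K] (t : K) {N M : ℕ} {l : YoungDiagram}
    (h : l.rowLen 0 ≤ M) : vDiagram t N l = ∏ i ∈ range (M + 1), vFactor t (mult N l i) := by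
  refine prod_subset (range_subset_range.mpr (by omega)) fun i _ hi => ?_
  rw [mult_eq_zero le_rfl (by simpa using hi)]
  simp [vFactor]

end Diagrams

/-! ### Generic rapidities and specialization -/

section Polynomials

variable {K : Type*} [Field K]

theorem ratVar_injective (N : ℕ) : Function.Injective (ratVar K : Fin N → RatFun K N) := fun _ _ h =>
  MvPolynomial.X_injective (IsFractionRing.injective _ _ h)

theorem ratVar_ne_zero {N : ℕ} (i : Fin N) : (ratVar K i : RatFun K N) ≠ 0 := fun h =>
  MvPolynomial.X_ne_zero i ((map_eq_zero_iff _ (IsFractionRing.injective _ _)).mp h)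

theorem ratVar_ne_mul (t : K) {N : ℕ} {i j : Fin N} (h : i ≠ j) :
    (ratVar K i : RatFun K N) ≠ ratConst N t * ratVar K j := by
  intro he
  rw [ratVar, ratVar, ratConst, ← map_mul] at he
  -- At the point with `x_i = 1` and all other coordinates zero the equation would read `1 = 0`.
  have := congrArg (MvPolynomial.eval (Pi.single i 1)) (IsFractionRing.injective _ (RatFun K N) he)
  simp [h.symm] at this

/-- `ratConst` as a ring homomorphism. -/
def ratConstHom (K : Type*) [Field K] (N : ℕ) : K →+* RatFun K N :=
  (algebraMap (MvPolynomial (Fin N) K) (RatFun K N)).comp MvPolynomial.C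

theorem ratConstHom_apply (N : ℕ) (c : K) : ratConstHom K N c = ratConst N c := rfl

theorem map_vFactor {L : Type*} [Field L] (φ : K →+* L) (t : K) (m : ℕ) :
    φ (vFactor t m) = vFactor (φ t) m := by
  simp [vFactor]

theorem hallLittlewoodRat_eq (t : K) (N : ℕ) (l : YoungDiagram) :
    hallLittlewoodRat t N l = (ratConst N (vDiagram t N l))⁻¹ *
      symmetrized (ratConst N t) (ratVar K) univ (List.ofFn fun i : Fin N => l.rowLen i) := by
  rw [symmetrized_univ, ← ratConstHom_apply, ← map_inv₀]
  rfl

theorem vFactor_ne_zero {t : K} (ht : ∀ m : ℕ, 0 < m → t ^ m ≠ 1) (m : ℕ) : vFactor t m ≠ 0 := by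
  refine prod_ne_zero_iff.mpr fun i hi => div_ne_zero ?_ ?_
  · exact sub_ne_zero.mpr (ht i (by simp at hi; omega)).symm
  · have := ht 1 one_pos
    rw [pow_one] at this
    exact sub_ne_zero.mpr this.symm

/-- The wave function of `k` sites and `N` particles with indeterminate rapidities. -/
def genericPsi (t : K) (k N : ℕ) : MvPolynomial ℕ (MvPolynomial (Fin N) K) :=
  modelPsi (MvPolynomial.C t) k ((List.finRange N).map MvPolynomial.X)

theorem map_genericPsi (t : K) (k N : ℕ) :
    MvPolynomial.map (algebraMap _ (RatFun K N)) (genericPsi t k N) =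
      bethe (ratConst N t) (ratVar K) k univ := by
  rw [genericPsi, ← modelPsi_map, List.map_map]
  have := modelPsi_eq_bethe (t := ratConst N t) (ratVar_injective N) (ratVar_ne_zero (K := K))
    (fun i j h => ratVar_ne_mul t h) k (List.nodup_finRange N)
  rw [show (List.finRange N).toFinset = univ by ext; simp] at this
  exact this

theorem coeff_genericPsi_ne_zero {t : K} {k N : ℕ} {n : ℕ →₀ ℕ}
    (h : MvPolynomial.coeff n (genericPsi t k N) ≠ 0) :
    (∀ i, k ≤ i → n i = 0) ∧ ∑ i ∈ range k, n i = N := by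
  have := coeff_bethe_ne_zero (t := ratConst N t) (x := ratVar K) k univ n
  rw [← map_genericPsi, MvPolynomial.coeff_map, card_univ, Fintype.card_fin] at this
  exact this fun h0 => h ((map_eq_zero_iff _ (IsFractionRing.injective _ _)).mp h0)

/-- Both sides are polynomials, so they may be compared in the fraction field, where
`coeff_bethe_mul` applies. As `t` is not a root of unity, `vDiagram t N l` can be cancelled. -/
theorem coeff_genericPsi {t : K} (ht : ∀ m : ℕ, 0 < m → t ^ m ≠ 1) {M N : ℕ} {l : YoungDiagram}
    (hl : l.rowLen 0 ≤ M) {n : ℕ →₀ ℕ} (hn : ∀ i, n i = mult N l i) :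
    MvPolynomial.coeff n (genericPsi t (M + 1) N) = hallLittlewoodP t N l := by
  refine IsFractionRing.injective _ (RatFun K N) ?_
  have ht1 : ratConst N t ≠ 1 := by
    have := ht 1 one_pos
    rw [pow_one] at this
    rw [← ratConstHom_apply]
    exact fun h => this ((ratConstHom K N).injective (h.trans (map_one _).symm))
  have hn' : (n : ℕ → ℕ) = mult N l := funext hn
  have h := coeff_bethe_mul ht1 (ratVar_injective N) (ratVar_ne_zero (K := K)) (M + 1) univ n
    (fun i hi => by rw [hn, mult_eq_zero hl (by omega)])
    (by rw [hn', sum_mult hl, card_univ, Fintype.card_fin])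
  have hv : ∏ i ∈ range (M + 1), vFactor (ratConst N t) (n i) = ratConst N (vDiagram t N l) := by
    rw [vDiagram_eq t hl, ← ratConstHom_apply, ← ratConstHom_apply, map_prod]
    simp only [map_vFactor, hn]
  have hv0 : ratConst N (vDiagram t N l) ≠ 0 := by
    rw [← ratConstHom_apply]
    refine (map_ne_zero _).mpr ?_
    rw [vDiagram_eq t hl]
    exact prod_ne_zero_iff.mpr fun i _ => vFactor_ne_zero ht _
  rw [hallLittlewoodP_spec, hallLittlewoodRat_eq, ofFn_rowLen hl, ← hn', ← h, hv,
    ← MvPolynomial.coeff_map, map_genericPsi]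
  field_simp

/-- The recursion for `modelBD` has no denominators, so arbitrary values, coinciding ones included,
may be substituted. -/
theorem modelPsi_eq_map_genericPsi (t : K) (k : ℕ) {N : ℕ} (x : Fin N → K) :
    modelPsi t k ((List.finRange N).map x) =
      MvPolynomial.map (MvPolynomial.eval x) (genericPsi t k N) := by
  rw [genericPsi, ← modelPsi_map, List.map_map, MvPolynomial.eval_C]
  congr 2
  funext i
  simp

/-- The occupation numbers of `l` as the exponent of a monomial. -/
def occupationExponent (N M : ℕ) (l : YoungDiagram) : ℕ →₀ ℕ :=
  Finsupp.onFinset (range (M + 1)) (fun i => if i < M + 1 then mult N l i else 0) fun i hi =>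
    mem_range.mpr (by by_contra h; exact hi (if_neg h))

theorem occupationExponent_apply {N M : ℕ} {l : YoungDiagram} (hl : l.rowLen 0 ≤ M) (i : ℕ) :
    occupationExponent N M l i = mult N l i := by
  rw [occupationExponent, Finsupp.onFinset_apply]
  split_ifs with h
  · rfl
  · rw [mult_eq_zero hl (by omega)]

theorem occupationExponent_fin {N M : ℕ} {l : YoungDiagram} (hl : l.rowLen 0 ≤ M) :
    (fun i : Fin (M + 1) => occupationExponent N M l i) = occupation N M l :=
  funext fun i => occupationExponent_apply hl i

theorem modelPsi_eq_sum {t : K} (ht : ∀ m : ℕ, 0 < m → t ^ m ≠ 1) (M : ℕ) {N : ℕ} (x : Fin N → K) :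
    modelPsi t (M + 1) ((List.finRange N).map x) = ∑ l ∈ box N M,
      MvPolynomial.monomial (occupationExponent N M l)
        (MvPolynomial.eval x (hallLittlewoodP t N l)) := by
  have hc : ∀ l ∈ box N M, MvPolynomial.eval x (hallLittlewoodP t N l) =
      MvPolynomial.coeff (occupationExponent N M l)
        (modelPsi t (M + 1) ((List.finRange N).map x)) := by
    intro l hl
    rw [modelPsi_eq_map_genericPsi, MvPolynomial.coeff_map,
      coeff_genericPsi ht (mem_box.mp hl).2 (occupationExponent_apply (mem_box.mp hl).2)]
  have hinj : Set.InjOn (occupationExponent N M) (box N M : Set YoungDiagram) := by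
    intro l hl l' hl' h
    rw [← diagramOf_occupation (mem_coe.mp hl), ← diagramOf_occupation (mem_coe.mp hl'),
      ← occupationExponent_fin (mem_box.mp (mem_coe.mp hl)).2,
      ← occupationExponent_fin (mem_box.mp (mem_coe.mp hl')).2, h]
  rw [sum_congr rfl fun l hl => by rw [hc l hl], ← sum_image
    (f := fun n => MvPolynomial.monomial n
      (MvPolynomial.coeff n (modelPsi t (M + 1) ((List.finRange N).map x)))) hinj]
  conv_lhs => rw [MvPolynomial.as_sum (modelPsi t (M + 1) ((List.finRange N).map x))]
  -- Every exponent in the support has total `N` on the sites `0, …, M`, hence comes from a diagram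
  -- in the box; the other diagrams contribute zero.
  refine sum_subset (fun n hn => ?_) fun n _ hn => ?_
  · rw [MvPolynomial.mem_support_iff, modelPsi_eq_map_genericPsi, MvPolynomial.coeff_map] at hn
    obtain ⟨h1, h2⟩ := coeff_genericPsi_ne_zero fun h => hn (by rw [h, map_zero])
    rw [sum_range] at h2
    have hb := diagramOf_mem_box h2
    refine mem_image.mpr ⟨_, hb, ?_⟩
    ext i
    by_cases hi : i < M + 1
    · have := congrFun (occupationExponent_fin (N := N) (mem_box.mp hb).2) ⟨i, hi⟩
      rw [occupation_diagramOf h2] at this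
      exact this
    · rw [h1 i (by omega), occupationExponent, Finsupp.onFinset_apply, if_neg hi]
  · rw [MvPolynomial.notMem_support_iff.mp hn, map_zero]

end Polynomials

/-! ### From the polynomial model to one chain -/

section OneChain

variable {K : Type*} [Field K]

theorem creation_ket (n : ℕ) : creation K (ket K n) = ket K (n + 1) := by
  simp [creation, ket, Finsupp.linearCombination_single]

theorem annihilation_ket (t : K) (n : ℕ) :
    annihilation t (ket K n) = qInt t n • ket K (n - 1) := by
  rw [annihilation, ket, Finsupp.linearCombination_single, one_smul]

/-- The vector `⨂ |nᵢ⟩` of a chain. -/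
def chainState (K : Type*) [Field K] (M : ℕ) (n : ℕ →₀ ℕ) : Chain K M :=
  ⨂ₜ[K] i : Fin (M + 1), ket K (n i)

theorem atSite_chainState {M : ℕ} (i : Fin (M + 1)) (f : Module.End K (Fock K)) (n n' : ℕ →₀ ℕ)
    (c : K) (h : f (ket K (n i)) = c • ket K (n' i)) (h' : ∀ j, j ≠ (i : ℕ) → n' j = n j) :
    atSite i f (chainState K M n) = c • chainState K M n' := by
  rw [atSite, chainState, PiTensorProduct.map_tprod, chainState]
  have h1 : (fun j => (Function.update (fun _ => LinearMap.id) i f :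
      Fin (M + 1) → Module.End K (Fock K)) j (ket K (n j))) =
      Function.update (fun j : Fin (M + 1) => ket K (n' j)) i (c • ket K (n' i)) := by
    funext j
    rcases eq_or_ne j i with rfl | hj
    · simp [h]
    · simp [hj, h' j fun h => hj (Fin.ext h)]
  rw [h1, MultilinearMap.map_update_smul, Function.update_eq_self]

/-- The passage from the polynomial model to the chain. -/
def toChain (K : Type*) [Field K] (M : ℕ) : MvPolynomial ℕ K →ₗ[K] Chain K M :=
  (MvPolynomial.basisMonomials ℕ K).constr K (chainState K M)

theorem toChain_monomial (M : ℕ) (n : ℕ →₀ ℕ) (c : K) :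
    toChain K M (MvPolynomial.monomial n c) = c • chainState K M n := by
  have : (MvPolynomial.monomial n c : MvPolynomial ℕ K) =
      c • MvPolynomial.basisMonomials ℕ K n := by
    simp [MvPolynomial.smul_monomial]
  rw [this, map_smul, toChain, Module.Basis.constr_basis]

theorem atSite_creation_toChain {M : ℕ} (i : Fin (M + 1)) (p : MvPolynomial ℕ K) :
    atSite i (creation K) (toChain K M p) = toChain K M (MvPolynomial.X (i : ℕ) * p) := by
  induction p using MvPolynomial.induction_on' with
  | monomial n c =>
    rw [MvPolynomial.X, MvPolynomial.monomial_mul, toChain_monomial, toChain_monomial, map_smul,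
      atSite_chainState i (creation K) n (Finsupp.single (i : ℕ) 1 + n) 1, one_smul, one_mul]
    · rw [creation_ket, one_smul]
      simp [add_comm]
    · intro j hj
      simp [hj.symm]
  | add p q hp hq => simp only [mul_add, map_add, hp, hq]

theorem atSite_annihilation_toChain {t : K} (ht : t ≠ 1) {M : ℕ} (i : Fin (M + 1))
    (p : MvPolynomial ℕ K) :
    (1 - t) • atSite i (annihilation t) (toChain K M p) = toChain K M (lowering t (i : ℕ) p) := by
  induction p using MvPolynomial.induction_on' with
  | monomial n c =>
    rw [lowering_monomial, toChain_monomial, toChain_monomial, map_smul,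
      atSite_chainState i (annihilation t) n (n - Finsupp.single (i : ℕ) 1) (qInt t (n i)),
      smul_smul, smul_smul]
    · have := sub_ne_zero.mpr ht.symm
      congr 1
      rw [qInt]
      field_simp
    · rw [annihilation_ket]
      simp
    · intro j hj
      simp [hj.symm]
  | add p q hp hq => simp only [smul_add, map_add, hp, hq]

/-- The monodromy matrix of one chain. -/
def chainMonodromy (t : K) (M : ℕ) (u : K) : Matrix (Fin 2) (Fin 2) (Module.End K (Chain K M)) :=
  ((List.finRange (M + 1)).reverse.map fun i =>
    lMatrix t u (atSite i (creation K)) (atSite i (annihilation t))).prod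

/-- The `L`-matrix of the `i`th site of a chain, and the identity for `i` outside of the chain. -/
def siteMatrix (t : K) (M : ℕ) (u : K) (i : ℕ) :
    Matrix (Fin 2) (Fin 2) (Module.End K (Chain K M)) :=
  if h : i < M + 1 then lMatrix t u (atSite ⟨i, h⟩ (creation K)) (atSite ⟨i, h⟩ (annihilation t))
  else 1

theorem chainMonodromy_eq (t : K) (M : ℕ) (u : K) :
    chainMonodromy t M u = ((List.range (M + 1)).reverse.map (siteMatrix t M u)).prod := by
  rw [chainMonodromy, ← List.map_coe_finRange_eq_range, ← List.map_reverse, List.map_map]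
  congr 2
  funext i
  rw [Function.comp_apply, siteMatrix, dif_pos i.isLt]

/-- `toChain` intertwines the site operators. The factor `u` on the right of the first equation
avoids the exponent `k - 1` at `k = 0`. -/
theorem prod_siteMatrix_toChain {t : K} (ht : t ≠ 1) (M : ℕ) {u : K} (hu : u ≠ 0) {k : ℕ}
    (hk : k ≤ M + 1) (p : MvPolynomial ℕ K) :
    u ^ k • ((List.range k).reverse.map (siteMatrix t M u)).prod 0 1 (toChain K M p) =
        u • toChain K M ((modelBD t (u ^ 2) k).1 p) ∧
      u ^ k • ((List.range k).reverse.map (siteMatrix t M u)).prod 1 1 (toChain K M p) =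
        toChain K M ((modelBD t (u ^ 2) k).2 p) := by
  induction k with
  | zero => simp [modelBD]
  | succ k ih =>
    obtain ⟨h1, h2⟩ := ih (by omega)
    rw [List.range_succ, List.reverse_append, List.reverse_singleton, List.singleton_append,
      List.map_cons, List.prod_cons]
    generalize ((List.range k).reverse.map (siteMatrix t M u)).prod = T at h1 h2
    rw [siteMatrix, dif_pos (by omega : k < M + 1), modelBD_succ_fst, modelBD_succ_snd, map_add,
      map_smul, map_add, ← atSite_creation_toChain ⟨k, by omega⟩,
      ← atSite_annihilation_toChain ht ⟨k, by omega⟩, ← h2]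
    have h1' : toChain K M ((modelBD t (u ^ 2) k).1 p) =
        (u⁻¹ * u ^ k) • T 0 1 (toChain K M p) := by
      rw [mul_smul, h1, smul_smul, inv_mul_cancel₀ hu, one_smul]
    constructor
    · simp only [lMatrix, Matrix.mul_apply, Fin.sum_univ_two, Matrix.of_apply, Matrix.cons_val',
        Matrix.cons_val_zero, Matrix.cons_val_one, Matrix.cons_val_fin_one, LinearMap.add_apply,
        Module.End.mul_apply, LinearMap.smul_apply, Module.End.one_apply, smul_add, map_smul,
        smul_smul, h1']
      congr 2
      · field_simp
        ring
      · ring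
    · simp only [lMatrix, Matrix.mul_apply, Fin.sum_univ_two, Matrix.of_apply, Matrix.cons_val',
        Matrix.cons_val_zero, Matrix.cons_val_one, Matrix.cons_val_fin_one, LinearMap.add_apply,
        Module.End.mul_apply, LinearMap.smul_apply, Module.End.one_apply, smul_add, map_smul,
        smul_smul, h1']
      congr 2
      · field_simp
        ring
      · ring

/-- The creation operator of one chain. -/
def chainB (t : K) (M : ℕ) (u : K) : Module.End K (Chain K M) := chainMonodromy t M u 0 1

theorem chainB_toChain {t : K} (ht : t ≠ 1) (M : ℕ) {u : K} (hu : u ≠ 0) (p : MvPolynomial ℕ K) :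
    chainB t M u (toChain K M p) =
      u ^ (-(M : ℤ)) • toChain K M ((modelBD t (u ^ 2) (M + 1)).1 p) := by
  have h := (prod_siteMatrix_toChain ht M hu le_rfl p).1
  rw [← chainMonodromy_eq, pow_succ', mul_smul] at h
  have h' := smul_right_injective (Chain K M) hu h
  rw [← h', smul_smul, zpow_neg, zpow_natCast, inv_mul_cancel₀ (pow_ne_zero _ hu), one_smul, chainB]

theorem prod_chainB_vacuum {t : K} (ht : t ≠ 1) (M : ℕ) {ι : Type*} {u : ι → K} (hu : ∀ i, u i ≠ 0)
    (js : List ι) :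
    (js.map fun j => chainB t M (u j)).prod (⨂ₜ[K] _, ket K 0) =
      (js.map u).prod ^ (-(M : ℤ)) •
        toChain K M (modelPsi t (M + 1) (js.map fun j => u j ^ 2)) := by
  induction js with
  | nil =>
    have : modelPsi t (M + 1) [] = MvPolynomial.monomial 0 1 := rfl
    simp only [List.map_nil, List.prod_nil, one_zpow, one_smul, this, toChain_monomial]
    rfl
  | cons j js ih =>
    rw [List.map_cons, List.prod_cons, Module.End.mul_apply, ih, map_smul, chainB_toChain ht M (hu j),
      List.map_cons, List.map_cons, modelPsi_cons, List.prod_cons, mul_zpow, smul_smul, mul_comm]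

theorem prod_chainB_eq_sum {t : K} (ht : ∀ m : ℕ, 0 < m → t ^ m ≠ 1) (M : ℕ) {N : ℕ} {u : Fin N → K}
    (hu : ∀ j, u j ≠ 0) :
    ((List.finRange N).map fun j => chainB t M (u j)).prod (⨂ₜ[K] _, ket K 0) =
      (∏ j, u j) ^ (-(M : ℤ)) • ∑ l ∈ box N M,
        MvPolynomial.eval (fun j => u j ^ 2) (hallLittlewoodP t N l) •
          ⨂ₜ[K] i, ket K (occupation N M l i) := by
  have ht1 : t ≠ 1 := by simpa using ht 1 one_pos
  rw [prod_chainB_vacuum ht1 M hu, modelPsi_eq_sum ht M fun j => u j ^ 2, map_sum,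
    ← List.ofFn_eq_map, List.prod_ofFn]
  congr 1
  refine sum_congr rfl fun l hl => ?_
  rw [toChain_monomial, chainState, ← occupationExponent_fin (mem_box.mp hl).2]

end OneChain

/-! ### Factorization over the two chains -/

section TwoChains

variable {K : Type*} [Field K]

/-- Tensoring with the identity is an algebra homomorphism, hence commutes with products of matrices
of operators. -/
theorem B₁_eq (t : K) (M₁ M₂ : ℕ) (u : K) :
    B₁ t M₁ M₂ u = Module.End.rTensorAlgHom K (Chain K M₁) (Chain K M₂) (chainB t M₁ u) := by
  have : monodromy₁ t M₁ M₂ u =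
      (Module.End.rTensorAlgHom K (Chain K M₁) (Chain K M₂)).mapMatrix (chainMonodromy t M₁ u) := by
    rw [monodromy₁, chainMonodromy, map_list_prod, List.map_map]
    congr 2
    funext i
    ext1 a b
    fin_cases a <;> fin_cases b <;> simp [lMatrix] <;> rfl
  rw [B₁, this]
  rfl

theorem B₂_eq (t : K) (M₁ M₂ : ℕ) (u : K) :
    B₂ t M₁ M₂ u = Module.End.lTensorAlgHom K (Chain K M₂) (Chain K M₁) (chainB t M₂ u) := by
  have : monodromy₂ t M₁ M₂ u =
      (Module.End.lTensorAlgHom K (Chain K M₂) (Chain K M₁)).mapMatrix (chainMonodromy t M₂ u) := by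
    rw [monodromy₂, chainMonodromy, map_list_prod, List.map_map]
    congr 2
    funext i
    ext1 a b
    fin_cases a <;> fin_cases b <;> simp [lMatrix] <;> rfl
  rw [B₂, this]
  rfl

theorem prod_B₂_mul_B₁ (t : K) (M₁ M₂ : ℕ) {ι : Type*} (u : ι → K) (js : List ι)
    (v : Chain K M₁) (w : Chain K M₂) :
    (js.map fun j => B₂ t M₁ M₂ (u j) * B₁ t M₁ M₂ (u j)).prod (v ⊗ₜ[K] w) =
      (js.map fun j => chainB t M₁ (u j)).prod v ⊗ₜ[K]
        (js.map fun j => chainB t M₂ (u j)).prod w := by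
  induction js with
  | nil => simp
  | cons j js ih =>
    simp only [List.map_cons, List.prod_cons, Module.End.mul_apply]
    rw [ih, B₁_eq, B₂_eq]
    rfl

theorem psiTilde_eq_sum {t : K} (ht : ∀ m : ℕ, 0 < m → t ^ m ≠ 1) (M₁ M₂ : ℕ) {N : ℕ}
    {u : Fin N → K} (hu : ∀ j, u j ≠ 0) :
    psiTilde t M₁ M₂ u = (∏ j, u j) ^ (-(M₁ : ℤ) - (M₂ : ℤ)) •
      ∑ l ∈ box N M₁, ∑ m ∈ box N M₂,
        (MvPolynomial.eval (fun j => u j ^ 2) (hallLittlewoodP t N l) *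
          MvPolynomial.eval (fun j => u j ^ 2) (hallLittlewoodP t N m)) •
          state K (occupation N M₁ l) (occupation N M₂ m) := by
  rw [psiTilde, List.ofFn_eq_map, state, prod_B₂_mul_B₁, prod_chainB_eq_sum ht M₁ hu,
    prod_chainB_eq_sum ht M₂ hu, TensorProduct.smul_tmul_smul, sub_eq_add_neg,
    zpow_add₀ (prod_ne_zero_iff.mpr fun j _ => hu j), TensorProduct.sum_tmul]
  congr 1
  refine sum_congr rfl fun l _ => ?_
  rw [TensorProduct.tmul_sum]
  refine sum_congr rfl fun m _ => ?_
  rw [TensorProduct.smul_tmul_smul, state]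

end TwoChains

theorem ratFunc_X_pow_ne_one {F : Type*} [Field F] {m : ℕ} (hm : 0 < m) :
    (RatFunc.X : RatFunc F) ^ m ≠ 1 := by
  intro h
  rw [← RatFunc.algebraMap_X, ← map_pow, ← map_one (algebraMap (Polynomial F) (RatFunc F))] at h
  have := congrArg Polynomial.natDegree (RatFunc.algebraMap_injective F h)
  simp at this
  omega

end QBoson

end

/-- `K` is `ℂ(t)` or any extension field of it (such as `ℂ(t)(u₁, …, u_N)`). -/
theorem mainTheorem7 {K : Type*} [Field K] [CharZero K] [Algebra (RatFunc ℂ) K]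
    (t : K) (ht : t = algebraMap (RatFunc ℂ) K RatFunc.X)
    (M₁ M₂ N : ℕ) (u : Fin N → K) (hu : ∀ j, u j ≠ 0) :
    QBoson.psiTilde t M₁ M₂ u =
        (∏ j, u j) ^ (-(M₁ : ℤ) - (M₂ : ℤ)) •
          ∑ l ∈ QBoson.box N M₁, ∑ m ∈ QBoson.box N M₂,
            (MvPolynomial.eval (fun j => u j ^ 2) (QBoson.hallLittlewoodP t N l) *
              MvPolynomial.eval (fun j => u j ^ 2) (QBoson.hallLittlewoodP t N m)) •
              QBoson.state K (QBoson.occupation N M₁ l) (QBoson.occupation N M₂ m) ∧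
      QBoson.jMap t M₁ M₂ (QBoson.psiTilde t M₁ M₂ u) =
        (∏ j, u j) ^ (-(M₁ : ℤ) - (M₂ : ℤ)) •
          ∑ l ∈ QBoson.box N M₁, ∑ m ∈ QBoson.box N M₂,
            (MvPolynomial.eval (fun j => u j ^ 2) (QBoson.hallLittlewoodP t N l) *
              MvPolynomial.eval (fun j => u j ^ 2) (QBoson.hallLittlewoodP t N m)) •
              QBoson.coupledQ t l m := by
  have ht' : ∀ m : ℕ, 0 < m → t ^ m ≠ 1 := by
    intro m hm h
    rw [ht, ← map_pow, ← map_one (algebraMap (RatFunc ℂ) K)] at h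
    exact QBoson.ratFunc_X_pow_ne_one hm ((algebraMap (RatFunc ℂ) K).injective h)
  have key := QBoson.psiTilde_eq_sum ht' M₁ M₂ hu
  refine ⟨key, ?_⟩
  simp only [key, map_smul, map_sum, QBoson.jMap_state]
  congr 1
  refine Finset.sum_congr rfl fun l hl => Finset.sum_congr rfl fun m hm => ?_
  -- Inside the boxes, the diagram read off from the occupation numbers is the original one.
  rw [QBoson.diagramOf_occupation hl, QBoson.diagramOf_occupation hm]
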